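/- Let $\sigma:\mathbb R\to\mathbb R$ be sigmoidal, i.e. the limits $\lim_{x\to-\infty}\sigma(x)$ and $\lim_{x\to\infty}\sigma(x)$ exist in $\mathbb R$ and are different, and there is $z\in\mathbb R$ such that $\sigma$ is continuously differentiable at $z$ and $\sigma'(z)\neq0$. Let $C,N,d_x\in\mathbb N$ and $\Delta>1$, and let $f_\theta=t_L\circ\sigma\circ t_{L-1}\circ\sigma\circ\cdots\circ\sigma\circ t_0$ be a fully connected $\sigma$ network with $L$ hidden layers, input dimension $d_0=d_x$, $d_\ell\ge3$ neurons in the $\ell$-th hidden layer ($1\le\ell\le L$) and output dimension $d_{L+1}=1$; here $\sigma$ acts coordinatewise, $t_\ell:\mathbb R^{d_\ell}\to\mathbb R^{d_{\ell+1}}$ are affine maps, and the parameter $\theta$ consists of all their weights and biases. Write $\log$ for the logarithm to base $2$. Suppose that for some integer $K$ with $2\le K\le\log N$ there are integers $0<L_1<L_2<\dots<L_K<L$ such that 1. $\displaystyle\prod_{\ell=1}^{L_1}\Big\lfloor\frac{d_\ell+1}{2}\Big\rfloor\ \ge\ \Delta\sqrt{2\pi d_x}$; 2. $\displaystyle\sum_{\ell=L_{i-1}+1}^{L_i}(d_\ell-2)\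 \ge\ 2^{i+3}$ for all integers $i$ with $1<i\le K-1$; 3. $\displaystyle 2^K\cdot\Big(\sum_{\ell=L_{K-1}+1}^{L_K}(d_\ell-2)\Big)\cdot\Big\lfloor\frac{L-L_K}{2\lceil\log C\rceil+1}\Big\rfloor\ \ge\ N^2+4$. Then the network can memorize every $\Delta$-separated set of $N$ pairs in dimension $d_x$ with $C$ classes. That is: for every set $\mathcal X\subset\mathbb R^{d_x}$ of exactly $N$ points with $$\sup_{x,x'\in\mathcal X,\,x\ne x'}\|x-x'\|_2\ <\ \Delta\cdot\inf_{x,x'\in\mathcal X,\,x\ne x'}\|x-x'\|_2,$$ every label function $y:\mathcal X\to\{0,1,\dots,C-1\}$ and every $\varepsilon>0$, there are parameters $\theta$ such that $|f_\theta(x)-y(x)|\le\varepsilon$ for all $x\in\mathcal X$. -/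

import Mathlib

open Filter Topology

namespace Memorization

/-- A function `σ : ℝ → ℝ` is *sigmoidal* if it has (finite) limits at `-∞` and at `+∞`, these two
limits differ, and `σ` is continuously differentiable at some point `z` (that is, differentiable
near `z`, with derivative continuous at `z`) with `σ' z ≠ 0`. -/
def Sigmoidal (σ : ℝ → ℝ) : Prop :=
  (∃ α β : ℝ, Tendsto σ atBot (𝓝 α) ∧ Tendsto σ atTop (𝓝 β) ∧ α ≠ β) ∧
    ∃ z : ℝ, (∀ᶠ x in 𝓝 z, DifferentiableAt ℝ σ x) ∧ ContinuousAt (deriv σ) z ∧ deriv σ z ≠ 0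

/-- A set `X` of points of `ℝⁿ` is `Δ`-*separated* if the supremum of the Euclidean distances
between distinct points of `X` is smaller than `Δ` times the infimum of these distances.
Supremum and infimum are taken in `[0, ∞]`, so that both always exist. -/
def Separated {n : ℕ} (Δ : ℝ) (X : Set (EuclideanSpace ℝ (Fin n))) : Prop :=
  (⨆ (x ∈ X) (x' ∈ X) (_ : x ≠ x'), edist x x') <
    ENNReal.ofReal Δ * ⨅ (x ∈ X) (x' ∈ X) (_ : x ≠ x'), edist x x'

/-- Parameters of a fully connected feedforward network with `L` hidden layers, input dimension
`d 0`, `d ℓ` neurons in the `ℓ`-th hidden layer (`1 ≤ ℓ ≤ L`) and output dimension `1`: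
the weights and biases of the affine maps `ℝ^(d ℓ) → ℝ^(d (ℓ + 1))` for `0 ≤ ℓ < L`,
and of the affine map `ℝ^(d L) → ℝ`. Values `d ℓ` with `ℓ > L` play no role. -/
structure Params (d : ℕ → ℕ) (L : ℕ) where
  weight : (ℓ : Fin L) → Matrix (Fin (d (ℓ + 1))) (Fin (d ℓ)) ℝ
  bias : (ℓ : Fin L) → Fin (d (ℓ + 1)) → ℝ
  outWeight : Fin (d L) → ℝ
  outBias : ℝ

/-- The vector of values of the `ℓ`-th layer on input `x`: layer `0` is the input, and layer
`ℓ + 1` is obtained from layer `ℓ` by an affine map followed by `σ` in every coordinate. -/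
def hidden (σ : ℝ → ℝ) {d : ℕ → ℕ} {L : ℕ} (θ : Params d L) (x : EuclideanSpace ℝ (Fin (d 0))) :
    (ℓ : ℕ) → ℓ ≤ L → Fin (d ℓ) → ℝ
  | 0, _ => fun j => x j
  | ℓ + 1, h => fun i =>
      σ (∑ j, θ.weight ⟨ℓ, h⟩ i j * hidden σ θ x ℓ (Nat.le_of_succ_le h) j + θ.bias ⟨ℓ, h⟩ i)

/-- The function `f_θ = t_L ∘ σ ∘ ⋯ ∘ t_1 ∘ σ ∘ t_0 : ℝ^(d 0) → ℝ` computed by the `σ` network with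
parameters `θ`; the last affine map `t_L` is not followed by `σ`. -/
def network (σ : ℝ → ℝ) {d : ℕ → ℕ} {L : ℕ} (θ : Params d L)
    (x : EuclideanSpace ℝ (Fin (d 0))) : ℝ :=
  ∑ j, θ.outWeight j * hidden σ θ x L le_rfl j + θ.outBias

/-- The `σ` network with `L` hidden layers and layer dimensions `d` *can memorize* the pairs
`(x, y x)`, `x ∈ X`, with labels in `{0, …, C - 1}`, if for every `ε > 0` its parameters can be
chosen so that its output is within `ε` of the label at every input of `X`. -/
def CanMemorize (σ : ℝ → ℝ) (d : ℕ → ℕ) (L : ℕ) {C : ℕ}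
    (X : Set (EuclideanSpace ℝ (Fin (d 0)))) (y : X → Fin C) : Prop :=
  ∀ ε : ℝ, 0 < ε → ∃ θ : Params d L, ∀ x : X, |network σ θ x - ((y x : ℕ) : ℝ)| ≤ ε

end Memorization

/-! The proof reduces memorization to arithmetic on integers. A union bound over at most `N² / 2`
slabs of the unit ball yields a direction in which no difference of two points shrinks by more than
a factor of order `N² √d_x` (`exists_direction`). Rescaled, the projected points have gaps at least
`1` and lie in `[0, Δ √(2π d_x) N² / 4]` (`Separated.exists_projection`), so their floors are
distinct integers. The fractional parts are carried along unchanged; they never affect a comparison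
with an integer.

On finitely many inputs a rescaled `σ` approximates both the identity and the step function, with
some tolerance for errors in its argument. A layer may therefore be treated as copying some values
exactly and applying step functions to others (`Approximable.layer`).

The integers are first folded into a shorter range without collisions. An interval of length at most
`D` is shifted cyclically modulo `D` into `[0, D)` at the price of two jumps, and counting forbidden
shifts shows that some shift works if (new points) · (old points) `< D` (`FoldsBelow.extend`). While
`D > N² / 4` this always holds, and a layer of width `d` divides the range by `⌊(d + 1) / 2⌋`:
condition 1. Below that, the intervals must contain few points: halving the range to about `N² / 2 ^
(i + 1)` takes `2 ^ (i + 2)` intervals, hence `2 ^ (i + 3)` jumps, spread over several layers: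
condition 2.

By condition 3 the final range is at most `A B`, with `A` the neurons available for jumps and `B`
the number of groups of `2 c + 1` layers that remain, where `c = ⌈log C⌉`. Each of `A` blocks of
length `B` receives one number encoding the labels of all its positions
(`Approximable.split_blocks`). The network then runs through the `B` positions, with two layers for
each of `c` bits and one layer to move on; a point keeps the label read when its own position comes
up (`Approximable.decode`). -/

namespace Memorization

/-! ### Layers up to uniform approximation on finitely many inputs -/

/-- The step function which jumps from `0` to `1` at `0`. -/
noncomputable def heaviside (t : ℝ) : ℝ := if 0 ≤ t then 1 else 0

/-- `IsLayer σ d inp ℓ H` says that some choice of the first `ℓ` layers of weights and biases makes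
`H a` the vector of values of the `ℓ`-th layer on the input `inp a`, for every index `a`. -/
inductive IsLayer {α : Type*} (σ : ℝ → ℝ) (d : ℕ → ℕ) (inp : α → EuclideanSpace ℝ (Fin (d 0))) :
    (ℓ : ℕ) → (α → Fin (d ℓ) → ℝ) → Prop
  | input : IsLayer σ d inp 0 fun a j => inp a j
  | layer {ℓ : ℕ} {H : α → Fin (d ℓ) → ℝ} (W : Matrix (Fin (d (ℓ + 1))) (Fin (d ℓ)) ℝ)
      (b : Fin (d (ℓ + 1)) → ℝ) (h : IsLayer σ d inp ℓ H) :
      IsLayer σ d inp (ℓ + 1) fun a i => σ (∑ j, W i j * H a j + b i)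

/-- A family `F` of real functions is approximable at layer `ℓ` if its members are simultaneously
uniform limits of affine functions of the values of the `ℓ`-th layer. -/
def Approximable {α ι : Type*} (σ : ℝ → ℝ) (d : ℕ → ℕ) (inp : α → EuclideanSpace ℝ (Fin (d 0)))
    (ℓ : ℕ) (F : ι → α → ℝ) : Prop :=
  ∀ ε : ℝ, 0 < ε → ∃ H, IsLayer σ d inp ℓ H ∧ ∃ (A : ι → Fin (d ℓ) → ℝ) (c : ι → ℝ),
    ∀ i a, |∑ j, A i j * H a j + c i - F i a| ≤ ε

variable {α ι κ : Type*} {σ : ℝ → ℝ} {d : ℕ → ℕ} {inp : α → EuclideanSpace ℝ (Fin (d 0))} {ℓ : ℕ}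

theorem IsLayer.exists_params {H : α → Fin (d ℓ) → ℝ} (h : IsLayer σ d inp ℓ H) :
    ∃ (W : (k : ℕ) → Matrix (Fin (d (k + 1))) (Fin (d k)) ℝ) (b : (k : ℕ) → Fin (d (k + 1)) → ℝ),
      ∀ (L : ℕ) (hL : ℓ ≤ L) (θ : Params d L),
        (∀ k : Fin L, (k : ℕ) < ℓ → θ.weight k = W k ∧ θ.bias k = b k) →
          ∀ a, hidden σ θ (inp a) ℓ hL = H a := by
  induction h with
  | input => exact ⟨fun _ => 0, fun _ => 0, fun L hL θ _ a => rfl⟩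
  | @layer ℓ H V c _ ih =>
    obtain ⟨W, b, hW⟩ := ih
    refine ⟨Function.update W ℓ V, Function.update b ℓ c, fun L hL θ hθ a => ?_⟩
    have h1 := hW L (Nat.le_of_succ_le hL) θ (fun k hk => by
      have := hθ k (Nat.lt_succ_of_lt hk)
      rwa [Function.update_of_ne hk.ne, Function.update_of_ne hk.ne] at this) a
    have h2 := hθ ⟨ℓ, hL⟩ (Nat.lt_succ_self ℓ)
    simp only [Function.update_self] at h2
    funext i
    simp only [hidden, h1, h2.1, h2.2]

theorem canMemorize_of_approximable {L C : ℕ} {X : Set (EuclideanSpace ℝ (Fin (d 0)))}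
    {y : X → Fin C}
    (h : ∀ ε : ℝ, 0 < ε → ∃ F : X → ℝ, Approximable σ d (fun x : X => x.1) L ![F] ∧
      ∀ x, |F x - ((y x : ℕ) : ℝ)| ≤ ε) : CanMemorize σ d L X y := by
  intro ε hε
  obtain ⟨F, hF, hy⟩ := h (ε / 2) (by positivity)
  obtain ⟨H, hH, A, c, hA⟩ := hF (ε / 2) (by positivity)
  obtain ⟨W, b, hW⟩ := hH.exists_params
  refine ⟨⟨fun k => W k, fun k => b k, A 0, c 0⟩, fun x => ?_⟩
  have h1 := hW L le_rfl ⟨fun k => W k, fun k => b k, A 0, c 0⟩ (fun _ _ => ⟨rfl, rfl⟩) x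
  have h2 := hA 0 x
  have h3 := hy x
  rw [Matrix.cons_val_zero] at h2
  simp only [network, h1]
  rw [abs_le] at *
  constructor <;> linarith

theorem approximable_input (A : ι → Fin (d 0) → ℝ) (c : ι → ℝ) :
    Approximable σ d inp 0 fun i a => ∑ j, A i j * inp a j + c i := fun ε hε =>
  ⟨_, .input, A, c, fun i a => by simpa using hε.le⟩

theorem exists_pos_forall_le {ι : Type*} [Finite ι] {δ : ι → ℝ} (hδ : ∀ i, 0 < δ i) :
    ∃ δ₀ > 0, ∀ i, δ₀ ≤ δ i := by
  cases isEmpty_or_nonempty ι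
  · exact ⟨1, one_pos, fun i => isEmptyElim i⟩
  · obtain ⟨i, hi⟩ := Finite.exists_min δ
    exact ⟨δ i, hδ i, hi⟩

theorem Approximable.affine [Fintype ι] [Finite κ] {F : ι → α → ℝ} {G : κ → α → ℝ}
    (hF : Approximable σ d inp ℓ F)
    (hG : ∀ k, ∃ (B : ι → ℝ) (c : ℝ), ∀ a, G k a = ∑ i, B i * F i a + c) :
    Approximable σ d inp ℓ G := by
  intro ε hε
  choose B c hG using hG
  have hS : ∀ k, 0 ≤ ∑ i, |B k i| := fun k => Finset.sum_nonneg fun _ _ => abs_nonneg _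
  obtain ⟨δ, hδ, hδ'⟩ := exists_pos_forall_le (δ := fun k => ε / (∑ i, |B k i| + 1))
    fun k => div_pos hε (by linarith [hS k])
  obtain ⟨H, hH, A, e, hA⟩ := hF δ hδ
  refine ⟨H, hH, fun k j => ∑ i, B k i * A i j, fun k => ∑ i, B k i * e i + c k, fun k a => ?_⟩
  have h1 : ∑ j, (∑ i, B k i * A i j) * H a j + (∑ i, B k i * e i + c k) - G k a =
      ∑ i, B k i * (∑ j, A i j * H a j + e i - F i a) := by
    rw [hG]
    simp only [Finset.sum_mul, mul_sub, mul_add, Finset.sum_sub_distrib, Finset.sum_add_distrib,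
      Finset.mul_sum]
    rw [Finset.sum_comm]
    simp only [mul_assoc]
    ring
  rw [h1]
  have h2 : (∑ i, |B k i| + 1) * δ ≤ ε := by
    have := hδ' k
    rw [le_div_iff₀ (by linarith [hS k])] at this
    linarith
  calc |∑ i, B k i * (∑ j, A i j * H a j + e i - F i a)|
      ≤ ∑ i, |B k i * (∑ j, A i j * H a j + e i - F i a)| := Finset.abs_sum_le_sum_abs _ _
    _ ≤ ∑ i, |B k i| * δ := Finset.sum_le_sum fun i _ => by
        rw [abs_mul]; exact mul_le_mul_of_nonneg_left (hA i a) (abs_nonneg _)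
    _ = (∑ i, |B k i|) * δ := by rw [Finset.sum_mul]
    _ ≤ ε := by linarith

/-- Around the point where its derivative does not vanish, a rescaled `σ` is close to the
identity. -/
theorem Sigmoidal.approx_id (hσ : Sigmoidal σ) {T : Set ℝ} (hT : T.Finite) {ε : ℝ} (hε : 0 < ε) :
    ∃ a b p q δ : ℝ, 0 < δ ∧ ∀ t ∈ T, ∀ t', |t' - t| ≤ δ → |p * σ (a * t' + b) + q - t| ≤ ε := by
  obtain ⟨z, hz, -, hz0⟩ := hσ.2
  have hd := hz.self_of_nhds.hasDerivAt
  set D := deriv σ z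
  obtain ⟨R, hR0, hR⟩ : ∃ R : ℝ, 0 < R ∧ ∀ t ∈ T, |t| ≤ R := by
    obtain ⟨R, hR⟩ := hT.isBounded.exists_norm_le
    exact ⟨max R 1, by positivity, fun t ht => (hR t ht).trans (le_max_left _ _)⟩
  have hD : 0 < |D| := abs_pos.2 hz0
  have hη : 0 < |D| * ε / (2 * (R + 1)) := by positivity
  have h1 := (hasDerivAt_iff_isLittleO.1 hd).def hη
  obtain ⟨ρ, hρ, h2⟩ := Metric.eventually_nhds_iff.1 h1
  -- With this scale, arguments within `1` of `T` stay within `ρ / 2` of `z`, where the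
  -- linearization is valid.
  have hlam : 0 < ρ / (2 * (R + 1)) := by positivity
  refine ⟨ρ / (2 * (R + 1)), z, 1 / (ρ / (2 * (R + 1)) * D), -σ z / (ρ / (2 * (R + 1)) * D),
    min 1 (ε / 2), by positivity, fun t ht t' htt' => ?_⟩
  set lam := ρ / (2 * (R + 1))
  have ht' : |t'| ≤ R + 1 := by
    have := abs_sub_abs_le_abs_sub t' t
    linarith [hR t ht, htt'.trans (min_le_left _ _)]
  have hlt : |lam * t'| ≤ lam * (R + 1) := by
    rw [abs_mul, abs_of_pos hlam]; gcongr
  have hle : lam * (R + 1) = ρ / 2 := by simp only [lam]; field_simp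
  have h3 := @h2 (lam * t' + z) (by rw [Real.dist_eq]; simp only [add_sub_cancel_right]; linarith)
  simp only [add_sub_cancel_right, Real.norm_eq_abs, smul_eq_mul] at h3
  have h4 : 1 / (lam * D) * σ (lam * t' + z) + -σ z / (lam * D) - t =
      (σ (lam * t' + z) - σ z - lam * t' * D) / (lam * D) + (t' - t) := by
    field_simp
    ring
  have h5 : |(σ (lam * t' + z) - σ z - lam * t' * D) / (lam * D)| ≤ ε / 2 := by
    rw [abs_div, div_le_iff₀ (by rw [abs_mul, abs_of_pos hlam]; positivity)]
    refine h3.trans ?_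
    calc |D| * ε / (2 * (R + 1)) * |lam * t'|
        ≤ |D| * ε / (2 * (R + 1)) * (lam * (R + 1)) := by gcongr
      _ = ε / 2 * |lam * D| := by rw [abs_mul, abs_of_pos hlam]; field_simp
  rw [h4]
  exact (abs_add_le _ _).trans (by linarith [htt'.trans (min_le_right _ _)])

/-- Far from `0`, a rescaled `σ` is close to the step function. -/
theorem Sigmoidal.approx_heaviside (hσ : Sigmoidal σ) {T : Set ℝ} (hT : T.Finite) {ε : ℝ}
    (hε : 0 < ε) :
    ∃ a b p q δ : ℝ, 0 < δ ∧
      ∀ t ∈ T, ∀ t', |t' - t| ≤ δ → |p * σ (a * t' + b) + q - heaviside t| ≤ ε := by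
  obtain ⟨A, B, hA, hB, hAB⟩ := hσ.1
  have hBA : B - A ≠ 0 := sub_ne_zero.2 hAB.symm
  have hBA' : 0 < |B - A| := abs_pos.2 hBA
  -- Since `T` is finite, there is a gap below `0`. The steep part of `σ` is placed inside it, near
  -- `-γ`, so that the value at `0` itself survives small errors.
  obtain ⟨γ, hγ, hγT⟩ : ∃ γ : ℝ, 0 < γ ∧ ∀ t ∈ T, t < 0 → t ≤ -(2 * γ) := by
    have := hT.to_subtype
    obtain ⟨δ, hδ, h⟩ := exists_pos_forall_le (ι := T)
      (δ := fun t => if t.1 < 0 then -t.1 else 1) fun t => by split_ifs <;> linarith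
    refine ⟨δ / 2, by positivity, fun t ht ht0 => ?_⟩
    have := h ⟨t, ht⟩
    simp only [ht0, if_true] at this
    linarith
  obtain ⟨u, hu⟩ := eventually_atBot.1 (Metric.tendsto_nhds.1 hA (ε * |B - A|) (by positivity))
  obtain ⟨v, hv⟩ := eventually_atTop.1 (Metric.tendsto_nhds.1 hB (ε * |B - A|) (by positivity))
  set S := |u| + |v| + 1
  have hS : 0 < S := by positivity
  refine ⟨2 * S / γ, 2 * S, 1 / (B - A), -A / (B - A), γ / 2, by positivity,
    fun t ht t' htt' => ?_⟩
  have hval : 2 * S / γ * t' + 2 * S = 2 * S / γ * (t' + γ) := by field_simp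
  rw [hval]
  rw [abs_le] at htt'
  have hc : 0 < 2 * S / γ := by positivity
  have hcS : 2 * S / γ * (γ / 2) = S := by field_simp
  have key : ∀ w e : ℝ, |w - (A + e * (B - A))| ≤ ε * |B - A| →
      |1 / (B - A) * w + -A / (B - A) - e| ≤ ε := by
    intro w e h
    have : 1 / (B - A) * w + -A / (B - A) - e = (w - (A + e * (B - A))) / (B - A) := by
      field_simp; ring
    rw [this, abs_div, div_le_iff₀ hBA']
    exact h
  unfold heaviside
  split_ifs with h0
  · apply key
    have : v ≤ 2 * S / γ * (t' + γ) := by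
      have : 2 * S / γ * (γ / 2) ≤ 2 * S / γ * (t' + γ) :=
        mul_le_mul_of_nonneg_left (by linarith) hc.le
      have := le_abs_self v
      have := abs_nonneg u
      simp only [S] at *
      linarith
    have := (hv _ this).le
    rw [Real.dist_eq] at this
    simpa using this
  · apply key
    have : 2 * S / γ * (t' + γ) ≤ u := by
      have h1 := hγT t ht (not_le.1 h0)
      have : 2 * S / γ * (t' + γ) ≤ 2 * S / γ * (-(γ / 2)) :=
        mul_le_mul_of_nonneg_left (by linarith) hc.le
      have := neg_abs_le u
      have := abs_nonneg v
      simp only [S] at *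
      linarith
    have := (hu _ this).le
    rw [Real.dist_eq] at this
    simpa using this

/-- A further layer carries over some members of the family and applies the step function to
others. -/
theorem Approximable.layer [Finite α] [Fintype ι] (hσ : Sigmoidal σ) {F G : ι → α → ℝ}
    (hF : Approximable σ d inp ℓ F) (hcard : Fintype.card ι ≤ d (ℓ + 1))
    (hG : ∀ i, G i = F i ∨ G i = fun a => heaviside (F i a)) :
    Approximable σ d inp (ℓ + 1) G := by
  intro ε hε
  have hloc : ∀ i, ∃ a b p q δ : ℝ, 0 < δ ∧
      ∀ x t', |t' - F i x| ≤ δ → |p * σ (a * t' + b) + q - G i x| ≤ ε := by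
    intro i
    rcases hG i with h | h
    · obtain ⟨a, b, p, q, δ, hδ, H⟩ := hσ.approx_id (Set.finite_range (F i)) hε
      exact ⟨a, b, p, q, δ, hδ, fun x t' ht => by rw [h]; exact H _ ⟨x, rfl⟩ t' ht⟩
    · obtain ⟨a, b, p, q, δ, hδ, H⟩ := hσ.approx_heaviside (Set.finite_range (F i)) hε
      exact ⟨a, b, p, q, δ, hδ, fun x t' ht => by rw [h]; exact H _ ⟨x, rfl⟩ t' ht⟩
  choose a b p q δ hδ hloc using hloc
  obtain ⟨δ₀, hδ₀, hδle⟩ := exists_pos_forall_le hδ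
  obtain ⟨H, hH, A, c, hA⟩ := hF δ₀ hδ₀
  obtain ⟨e⟩ : Nonempty (ι ↪ Fin (d (ℓ + 1))) :=
    Function.Embedding.nonempty_of_card_le (by simpa using hcard)
  -- Each member of the family gets its own neuron; surplus neurons get zero weights and are ignored
  -- by the output.
  refine ⟨_, hH.layer (Function.extend e (fun i j => a i * A i j) fun _ _ => 0)
    (Function.extend e (fun i => a i * c i + b i) fun _ => 0),
    fun i k => if k = e i then p i else 0, q, fun i x => ?_⟩
  simp only [ite_mul, zero_mul, Finset.sum_ite_eq', Finset.mem_univ, if_true,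
    e.injective.extend_apply]
  have h1 : ∑ j, a i * A i j * H x j + (a i * c i + b i) =
      a i * (∑ j, A i j * H x j + c i) + b i := by
    rw [mul_add, Finset.mul_sum]
    simp only [mul_assoc]
    ring
  rw [h1]
  exact hloc i x _ ((hA i x).trans (hδle i))

/-! ### Folding finite sets of integers by step functions -/

/-- The step function on `ℤ` which starts at `0` and, for every pair `(t, c)` of the list, jumps by
`c` at `t`. -/
def jumps (l : List (ℤ × ℤ)) (s : ℤ) : ℤ := (l.map fun p => if p.1 ≤ s then p.2 else 0).sum

@[simp] theorem jumps_nil (s : ℤ) : jumps [] s = 0 := rfl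

@[simp] theorem jumps_cons (p : ℤ × ℤ) (l : List (ℤ × ℤ)) (s : ℤ) :
    jumps (p :: l) s = (if p.1 ≤ s then p.2 else 0) + jumps l s := by
  simp [jumps]

/-- With one more jump, a step function can be made constant from a given point on. -/
theorem exists_jumps_cut (l : List (ℤ × ℤ)) (τ v : ℤ) :
    ∃ l' : List (ℤ × ℤ), l'.length = l.length + 1 ∧ (∀ s < τ, jumps l' s = jumps l s) ∧
      ∀ s, τ ≤ s → jumps l' s = v := by
  induction l generalizing v with
  | nil => exact ⟨[(τ, v)], rfl, fun s hs => by simp [not_le.2 hs], fun s hs => by simp [hs]⟩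
  | cons p l ih =>
    by_cases hp : p.1 ≤ τ
    · obtain ⟨l', h1, h2, h3⟩ := ih (v - p.2)
      refine ⟨p :: l', by simp [h1], fun s hs => by simp [h2 s hs], fun s hs => ?_⟩
      simp [h3 s hs, hp.trans hs]
    · obtain ⟨l', h1, h2, h3⟩ := ih v
      refine ⟨(p.1, 0) :: l', by simp [h1], fun s hs => ?_, fun s hs => by simp [h3 s hs]⟩
      simp [h2 s hs, show ¬ p.1 ≤ s by omega]

/-- The map `s ↦ s + jumps l s` folds the part of `S` below `τ` injectively into `[0, D)`. -/
def FoldsBelow (S : Finset ℤ) (D : ℤ) (l : List (ℤ × ℤ)) (τ : ℤ) : Prop :=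
  (∀ s ∈ S, s < τ → 0 ≤ s + jumps l s ∧ s + jumps l s < D) ∧
    ∀ s ∈ S, s < τ → ∀ s' ∈ S, s' < τ → s + jumps l s = s' + jumps l s' → s = s'

/-- An interval of length at most `D` is shifted cyclically modulo `D`, which takes two jumps; if
the number of pairs of an old and a new point is below `D`, then some shift avoids collisions. -/
theorem FoldsBelow.extend {S : Finset ℤ} {D : ℤ} {l : List (ℤ × ℤ)} {τ τ' : ℤ}
    (h : FoldsBelow S D l τ) (hD : 0 < D) (hττ : τ' - τ ≤ D)
    (hcard : ((S.filter fun s => τ ≤ s ∧ s < τ').card * (S.filter fun s => s < τ).card : ℕ) < D) :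
    ∃ l' : List (ℤ × ℤ), l'.length = l.length + 2 ∧ FoldsBelow S D l' τ' := by
  set U := S.filter fun s => τ ≤ s ∧ s < τ'
  set V := S.filter fun s => s < τ
  -- Each pair of a new and an old point forbids a single residue for the shift `c`, and there are
  -- fewer than `D` pairs.
  obtain ⟨c, hc, hc'⟩ : ∃ c ∈ Finset.Ico 0 D,
      c ∉ (U ×ˢ V).image fun p => (p.2 + jumps l p.2 - p.1) % D := by
    by_contra! hcon
    have h1 := Finset.card_le_card (show Finset.Ico 0 D ⊆ _ from hcon)
    have h2 := h1.trans Finset.card_image_le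
    rw [Finset.card_product, Int.card_Ico] at h2
    omega
  rw [Finset.mem_Ico] at hc
  have hnew : ∀ s ∈ S, τ ≤ s → s < τ' → ∀ p ∈ S, p < τ → (s + c) % D ≠ p + jumps l p := by
    intro s hs h1 h2 p hp h3 heq
    apply hc'
    rw [Finset.mem_image]
    refine ⟨(s, p), by simp [U, V, *], ?_⟩
    simp only [← heq]
    rw [Int.emod_sub_emod, add_sub_cancel_left]
    exact Int.emod_eq_of_lt hc.1 hc.2
  -- On an interval of length at most `D`, `s + c` passes at most one multiple of `D`, namely `D (q
  -- + 1)`. Reduction modulo `D` is thus a shift by `c - D q` and, beyond it, by `c - D (q + 1)`: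
  -- one cut for each.
  set q := (τ + c) / D
  obtain ⟨l₁, hl₁, h1, h1'⟩ := exists_jumps_cut l τ (c - D * q)
  obtain ⟨l₂, hl₂, h2, h2'⟩ := exists_jumps_cut l₁ (D * (q + 1) - c) (c - D * (q + 1))
  have hq1 : D * q ≤ τ + c := Int.mul_ediv_self_le hD.ne'
  have hq2 : τ + c < D * (q + 1) := by
    have := Int.lt_ediv_add_one_mul_self (τ + c) hD
    rwa [mul_comm] at this
  have hold : ∀ s < τ, jumps l₂ s = jumps l s := fun s hs => by
    rw [h2 s (by omega), h1 s hs]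
  have hmod : ∀ s, τ ≤ s → s < τ' → s + jumps l₂ s = (s + c) % D := by
    intro s hs hs'
    rcases lt_or_ge s (D * (q + 1) - c) with hlt | hge
    · rw [h2 s hlt, h1' s hs]
      have : (s + c) / D = q := by
        rw [Int.ediv_eq_iff_of_pos hD]
        constructor <;> nlinarith
      rw [Int.emod_def, this]
      ring
    · rw [h2' s hge]
      have : (s + c) / D = q + 1 := by
        rw [Int.ediv_eq_iff_of_pos hD]
        constructor <;> nlinarith
      rw [Int.emod_def, this]
      ring
  refine ⟨l₂, by omega, fun s hs hs' => ?_, fun s hs hs' t ht ht' heq => ?_⟩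
  · rcases lt_or_ge s τ with hlt | hge
    · rw [hold s hlt]
      exact h.1 s hs hlt
    · rw [hmod s hge hs']
      exact ⟨Int.emod_nonneg _ hD.ne', Int.emod_lt_of_pos _ hD⟩
  · rcases lt_or_ge s τ with hlt | hge <;> rcases lt_or_ge t τ with hlt' | hge'
    · rw [hold s hlt, hold t hlt'] at heq
      exact h.2 s hs hlt t ht hlt' heq
    · rw [hold s hlt, hmod t hge' ht'] at heq
      exact absurd heq.symm (hnew t ht hge' ht' s hs hlt)
    · rw [hold t hlt', hmod s hge hs'] at heq
      exact absurd heq (hnew s hs hge hs' t ht hlt')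
    · rw [hmod s hge hs', hmod t hge' ht'] at heq
      have h4 : (s - t) % D = 0 := by
        have := Int.emod_eq_emod_iff_emod_sub_eq_zero.1 heq
        rwa [add_sub_add_right_eq_sub] at this
      have h5 := Int.eq_zero_of_abs_lt_dvd (Int.dvd_of_emod_eq_zero h4)
        (abs_lt.2 ⟨by omega, by omega⟩)
      omega

theorem foldsBelow_nil {S : Finset ℤ} {D : ℤ} (hS : ∀ s ∈ S, 0 ≤ s) : FoldsBelow S D [] D :=
  ⟨fun s hs h => by simpa using ⟨hS s hs, h⟩, fun s _ _ t _ _ h => by simpa using h⟩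

/-- Folding `[0, P D)` into `[0, D)` in blocks of length `D`. -/
theorem exists_foldsBelow_blocks {S : Finset ℤ} {D : ℤ} (hS : ∀ s ∈ S, 0 ≤ s) (hD : 0 < D)
    (hcard : (S.card : ℤ) ^ 2 < 4 * D) (P : ℕ) :
    ∃ l : List (ℤ × ℤ), l.length = 2 * P ∧ FoldsBelow S D l ((P + 1 : ℕ) * D) := by
  induction P with
  | zero => exact ⟨[], rfl, by simpa using foldsBelow_nil hS⟩
  | succ P ih =>
    obtain ⟨l, hl, h⟩ := ih
    set τ := ((P + 1 : ℕ) : ℤ) * D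
    set τ' := ((P + 1 + 1 : ℕ) : ℤ) * D with hτ'
    have hττ : τ' = τ + D := by simp only [τ, τ']; push_cast; ring
    have hprod : ((S.filter fun s => τ ≤ s ∧ s < τ').card *
        (S.filter fun s => s < τ).card : ℕ) < D := by
      have hdisj : Disjoint (S.filter fun s => τ ≤ s ∧ s < τ') (S.filter fun s => s < τ) :=
        Finset.disjoint_filter.2 fun s _ h1 h2 => by omega
      have hle := Finset.card_le_card (Finset.union_subset
        (Finset.filter_subset (fun s => τ ≤ s ∧ s < τ') S)
        (Finset.filter_subset (fun s => s < τ) S))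
      rw [Finset.card_union_of_disjoint hdisj] at hle
      push_cast
      zify at hle
      set a : ℤ := ((S.filter fun s => τ ≤ s ∧ s < τ').card : ℤ)
      set b : ℤ := ((S.filter fun s => s < τ).card : ℤ)
      have ha : 0 ≤ a := Int.natCast_nonneg _
      have hb : 0 ≤ b := Int.natCast_nonneg _
      -- `a b ≤ (a + b)² / 4`: this is the source of the threshold `N² / 4` for unrestricted blocks.
      nlinarith [sq_nonneg (a - b)]
    obtain ⟨l', hl', h'⟩ := h.extend hD (by omega) hprod
    exact ⟨l', by omega, h'⟩

/-- Intervals with at most `m` points can be processed one after another. -/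
theorem FoldsBelow.extend_upto {S : Finset ℤ} {D : ℤ} {m : ℕ} (hD : 0 < D)
    (hmD : ((m * S.card : ℕ) : ℤ) < D) (τ' : ℤ) (k : ℕ) :
    ∀ (l : List (ℤ × ℤ)) (τ : ℤ), FoldsBelow S D l τ → τ ≤ τ' → τ' - τ ≤ D →
      (S.filter fun s => τ ≤ s ∧ s < τ').card ≤ k * m →
        ∃ l' : List (ℤ × ℤ), l'.length ≤ l.length + 2 * k ∧ FoldsBelow S D l' τ' := by
  induction k with
  | zero =>
    intro l τ h _ _ hcard
    have hemp : S.filter (fun s => τ ≤ s ∧ s < τ') = ∅ := by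
      rw [← Finset.card_eq_zero]; omega
    have hlt : ∀ s ∈ S, s < τ' → s < τ := fun s hs hs' => by
      by_contra hcon
      have : s ∈ S.filter (fun s => τ ≤ s ∧ s < τ') := by
        rw [Finset.mem_filter]; exact ⟨hs, not_lt.1 hcon, hs'⟩
      rw [hemp] at this
      simp at this
    exact ⟨l, le_self_add, fun s hs hs' => h.1 s hs (hlt s hs hs'),
      fun s hs hs' t ht ht' => h.2 s hs (hlt s hs hs') t ht (hlt t ht ht')⟩
  | succ k ih =>
    intro l τ h hτ hlen hcard
    set cnt : ℕ → ℕ := fun n => (S.filter fun s => τ ≤ s ∧ s < τ + n).card with hcnt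
    obtain ⟨n, hn, hnD, hrest⟩ : ∃ n : ℕ, cnt n ≤ m ∧ τ + n ≤ τ' ∧
        (S.filter fun s => τ + n ≤ s ∧ s < τ').card ≤ k * m := by
      obtain ⟨T, hT⟩ := Int.eq_ofNat_of_zero_le (sub_nonneg.2 hτ)
      have h0 : cnt 0 ≤ m := by
        simp only [hcnt]
        rw [Finset.filter_false_of_mem fun s _ => by omega]
        simp
      -- Greedy choice: the longest initial interval with at most `m` points. Lengthening it by one
      -- adds at most one point, so if it stops early it has exactly `m` points and at most `k * m`
      -- remain.
      set n := Nat.findGreatest (fun n => cnt n ≤ m) T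
      have hnT : n ≤ T := Nat.findGreatest_le T
      have hn : cnt n ≤ m := Nat.findGreatest_spec (P := fun n => cnt n ≤ m) (Nat.zero_le T) h0
      refine ⟨n, hn, by omega, ?_⟩
      rcases hnT.eq_or_lt with heq | hlt
      · rw [Finset.filter_false_of_mem fun s _ => by omega]
        simp
      · have hsucc : ¬ cnt (n + 1) ≤ m :=
          Nat.findGreatest_is_greatest (P := fun n => cnt n ≤ m) (Nat.lt_succ_self n) hlt
        have hle : cnt (n + 1) ≤ cnt n + 1 := by
          have hsub : (S.filter fun s => τ ≤ s ∧ s < τ + (n + 1 : ℕ)) ⊆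
              insert (τ + n) (S.filter fun s => τ ≤ s ∧ s < τ + n) := by
            intro s hs
            simp only [Finset.mem_filter, Finset.mem_insert] at hs ⊢
            push_cast at hs
            by_cases hs' : s = τ + n
            · exact .inl hs'
            · exact .inr ⟨hs.1, hs.2.1, by omega⟩
          exact (Finset.card_le_card hsub).trans (Finset.card_insert_le _ _)
        have hdisj : Disjoint (S.filter fun s => τ ≤ s ∧ s < τ + n)
            (S.filter fun s => τ + n ≤ s ∧ s < τ') :=
          Finset.disjoint_filter.2 fun s _ h1 h2 => by omega
        have hsub : (S.filter fun s => τ ≤ s ∧ s < τ + n) ∪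
            (S.filter fun s => τ + n ≤ s ∧ s < τ') ⊆ S.filter fun s => τ ≤ s ∧ s < τ' := by
          intro s hs
          simp only [Finset.mem_union, Finset.mem_filter] at hs ⊢
          rcases hs with hs | hs
          · exact ⟨hs.1, hs.2.1, by omega⟩
          · exact ⟨hs.1, by omega, hs.2.2⟩
        have hle2 := Finset.card_le_card hsub
        rw [Finset.card_union_of_disjoint hdisj] at hle2
        change cnt n + _ ≤ _ at hle2
        have : (k + 1) * m = k * m + m := by ring
        omega
    obtain ⟨l₁, hl₁, h₁⟩ := h.extend (τ' := τ + n) hD (by omega) (by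
      refine lt_of_le_of_lt ?_ hmD
      exact_mod_cast Nat.mul_le_mul hn (Finset.card_filter_le _ _))
    obtain ⟨l₂, hl₂, h₂⟩ := ih l₁ (τ + n) h₁ hnD (by omega) hrest
    exact ⟨l₂, by omega, h₂⟩

/-- Folding `[0, 2 D)` into `[0, D)`, for `D` larger than `m` times the number of points. -/
theorem exists_foldsBelow_halve {S : Finset ℤ} {D : ℤ} (hS : ∀ s ∈ S, 0 ≤ s) (hD : 0 < D) {m k : ℕ}
 (hmD : ((m * S.card : ℕ) : ℤ) < D)
    (hk : S.card ≤ k * m) :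
    ∃ l : List (ℤ × ℤ), l.length ≤ 2 * k ∧ FoldsBelow S D l (2 * D) := by
  simpa using FoldsBelow.extend_upto hD hmD (2 * D) k [] D (foldsBelow_nil hS) (by omega)
    (by omega) ((Finset.card_filter_le _ _).trans hk)

/-! ### Jumps realized by layers -/

theorem Approximable.congr {F G : ι → α → ℝ} (h : Approximable σ d inp ℓ F)
    (hFG : ∀ i a, F i a = G i a) : Approximable σ d inp ℓ G := by
  obtain rfl : F = G := funext₂ hFG
  exact h

theorem Approximable.layer_of_affine [Finite α] [Fintype ι] [Fintype κ] (hσ : Sigmoidal σ)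
    {F : ι → α → ℝ} (hF : Approximable σ d inp ℓ F) {n : ℕ} {P : κ → α → ℝ} {Q : Fin n → α → ℝ}
    (hP : ∀ k, ∃ (B : ι → ℝ) (c : ℝ), ∀ a, P k a = ∑ i, B i * F i a + c)
    (hQ : ∀ k, ∃ (B : ι → ℝ) (c : ℝ), ∀ a, Q k a = ∑ i, B i * F i a + c)
    (hcard : Fintype.card κ + n ≤ d (ℓ + 1)) :
    Approximable σ d inp (ℓ + 1) (Sum.elim P fun j a => heaviside (Q j a)) := by
  have h : Approximable σ d inp ℓ (Sum.elim P Q) := hF.affine (by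
    rintro (k | k)
    · exact hP k
    · exact hQ k)
  refine h.layer hσ (by simpa using hcard) ?_
  rintro (k | k)
  · exact .inl rfl
  · exact .inr rfl

/-- Two values are carried through a layer, and both are changed by jumps at the same points of the
first one. -/
theorem Approximable.jump_layer_pair [Finite α] (hσ : Sigmoidal σ) {x w : α → ℝ}
    (h : Approximable σ d inp ℓ ![x, w]) {n : ℕ} (t c e : Fin n → ℝ) (hn : 2 + n ≤ d (ℓ + 1)) :
    Approximable σ d inp (ℓ + 1) ![fun a => x a + ∑ j, c j * heaviside (x a - t j),
      fun a => w a + ∑ j, e j * heaviside (x a - t j)] := by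
  have h1 := h.layer_of_affine hσ (P := ![x, w]) (Q := fun j a => x a - t j)
    (Fin.forall_fin_two.2 ⟨⟨![1, 0], 0, fun a => by simp⟩, ⟨![0, 1], 0, fun a => by simp⟩⟩)
    (fun j => ⟨![1, 0], -t j, fun a => by simp; ring⟩) (by simpa using hn)
  refine h1.affine (Fin.forall_fin_two.2
    ⟨⟨Sum.elim ![1, 0] c, 0, fun a => ?_⟩, ⟨Sum.elim ![0, 1] e, 0, fun a => ?_⟩⟩)
  · simp
  · simp

theorem Approximable.jump_layer [Finite α] (hσ : Sigmoidal σ) {x : α → ℝ}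
    (h : Approximable σ d inp ℓ ![x]) {n : ℕ} (t c : Fin n → ℝ) (hn : 1 + n ≤ d (ℓ + 1)) :
    Approximable σ d inp (ℓ + 1) ![fun a => x a + ∑ j, c j * heaviside (x a - t j)] := by
  have h1 := h.layer_of_affine hσ (P := ![x]) (Q := fun j a => x a - t j)
    (fun _ => ⟨![1], 0, fun a => by simp⟩)
    (fun j => ⟨![1], -t j, fun a => by simp; ring⟩) (by simpa using hn)
  exact h1.affine fun _ => ⟨Sum.elim ![1] c, 0, fun a => by simp⟩

theorem Approximable.carry [Finite α] (hσ : Sigmoidal σ) {x : α → ℝ}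
    (h : Approximable σ d inp ℓ ![x]) (n : ℕ) (hd : ∀ i < n, 1 ≤ d (ℓ + 1 + i)) :
    Approximable σ d inp (ℓ + n) ![x] := by
  induction n with
  | zero => exact h
  | succ n ih =>
    have := (ih fun i hi => hd i (by omega)).jump_layer hσ (n := 0) Fin.elim0 Fin.elim0 (by
      have := hd n (by omega)
      rwa [Nat.add_right_comm] at this)
    exact this.congr (by simp)

theorem heaviside_sub_intCast (s t : ℤ) {f : ℝ} (hf : 0 ≤ f ∧ f < 1) :
    heaviside ((s : ℝ) + f - t) = if t ≤ s then 1 else 0 := by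
  unfold heaviside
  congr 1
  rw [eq_iff_iff]
  constructor
  · intro h
    by_contra hcon
    have : (s : ℝ) + 1 ≤ t := by exact_mod_cast not_le.1 hcon
    linarith
  · intro h
    have : (t : ℝ) ≤ s := by exact_mod_cast h
    linarith

theorem jumps_append (l l' : List (ℤ × ℤ)) (s : ℤ) : jumps (l ++ l') s = jumps l s + jumps l' s := by
  simp [jumps]

theorem intCast_jumps (l : List (ℤ × ℤ)) (s : ℤ) {f : ℝ} (hf : 0 ≤ f ∧ f < 1) :
    (jumps l s : ℝ) = ∑ j : Fin l.length, ((l[j].2 : ℤ) : ℝ) * heaviside (s + f - (l[j].1 : ℤ)) := by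
  induction l with
  | nil => simp
  | cons p l ih =>
    rw [jumps_cons, Int.cast_add, ih]
    simp only [List.length_cons]
    rw [Fin.sum_univ_succ]
    congr 1
    simp [heaviside_sub_intCast _ _ hf]

/-- When all jumps fit into one layer, the old value need not survive, so a single neuron suffices
to carry it. -/
theorem Approximable.fold_layer [Finite α] (hσ : Sigmoidal σ) {s : α → ℤ} {f : α → ℝ}
    (hf : ∀ a, 0 ≤ f a ∧ f a < 1) (h : Approximable σ d inp ℓ ![fun a => (s a : ℝ) + f a])
    (l : List (ℤ × ℤ)) (hl : 1 + l.length ≤ d (ℓ + 1)) :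
    Approximable σ d inp (ℓ + 1) ![fun a => ((s a + jumps l (s a) : ℤ) : ℝ) + f a] := by
  convert h.jump_layer hσ (fun j : Fin l.length => (l[j].1 : ℝ)) (fun j => (l[j].2 : ℝ)) hl
    using 3 with a
  rw [Int.cast_add, intCast_jumps l (s a) (hf a)]
  ring

/-- Jumps spread over several layers must all be triggered by the same unmodified value, so a second
neuron is needed for the running total. This is why a layer of width `d` contributes only `d - 2`
jumps. -/
theorem Approximable.accumulate_jumps [Finite α] (hσ : Sigmoidal σ) {s : α → ℤ} {f w : α → ℝ}
    (hf : ∀ a, 0 ≤ f a ∧ f a < 1) (h : Approximable σ d inp ℓ ![fun a => (s a : ℝ) + f a, w])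
    (n : ℕ) (hd : ∀ i < n, 3 ≤ d (ℓ + 1 + i)) (l : List (ℤ × ℤ))
    (hl : l.length ≤ ∑ i ∈ Finset.range n, (d (ℓ + 1 + i) - 2)) :
    Approximable σ d inp (ℓ + n) ![fun a => (s a : ℝ) + f a, fun a => w a + jumps l (s a)] := by
  induction n generalizing l with
  | zero =>
    have : l = [] := by simpa using hl
    simpa [this] using h
  | succ n ih =>
    set q := ∑ i ∈ Finset.range n, (d (ℓ + 1 + i) - 2)
    rw [Finset.sum_range_succ] at hl
    have h1 := ih (fun i hi => hd i (by omega)) (l.take q) (by simp)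
    have h3 := hd n (by omega)
    have h2 := h1.jump_layer_pair hσ (fun j : Fin (l.drop q).length => ((l.drop q)[j].1 : ℝ))
      (fun _ => 0) (fun j => ((l.drop q)[j].2 : ℝ)) (by
        rw [List.length_drop, Nat.add_right_comm ℓ n 1]
        omega)
    refine h2.congr (Fin.forall_fin_two.2 ⟨fun a => by simp, fun a => ?_⟩)
    simp only [Matrix.cons_val_one, Matrix.cons_val_zero]
    rw [← intCast_jumps _ (s a) (hf a), add_assoc, ← Int.cast_add, ← jumps_append,
      List.take_append_drop]

/-! ### Folding by layers -/

/-- The folded values are injective and lie in `[0, D)`. -/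
theorem FoldsBelow.comp [Fintype α] {s : α → ℤ} (hs : Function.Injective s) {D τ : ℤ}
    {l : List (ℤ × ℤ)} (h : FoldsBelow (Finset.univ.image s) D l τ) (hτ : ∀ a, s a < τ) :
    (Function.Injective fun a => s a + jumps l (s a)) ∧
      ∀ a, 0 ≤ s a + jumps l (s a) ∧ s a + jumps l (s a) < D :=
  ⟨fun a b hab => hs (h.2 _ (by simp) (hτ a) _ (by simp) (hτ b) hab),
    fun a => h.1 _ (by simp) (hτ a)⟩

/-- The induction removes the last layer: earlier layers fold into longer ranges, where the
condition `N² < 4 T` is only weaker. Width `d` leaves room for `2 P` jumps with `P + 1 = ⌊(d + 1) /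
2⌋`. -/
theorem exists_fold_blocks_layers [Fintype α] (hσ : Sigmoidal σ) {f : α → ℝ}
    (hf : ∀ a, 0 ≤ f a ∧ f a < 1) {s : α → ℤ} (hs : Function.Injective s)
    (h : Approximable σ d inp ℓ ![fun a => (s a : ℝ) + f a]) (n : ℕ)
    (hd : ∀ i < n, 3 ≤ d (ℓ + 1 + i)) {T : ℤ} (hT : 0 < T)
    (hcard : (Fintype.card α : ℤ) ^ 2 < 4 * T)
    (hsT : ∀ a, 0 ≤ s a ∧ s a < (∏ i ∈ Finset.range n, ((d (ℓ + 1 + i) + 1) / 2) : ℕ) * T) :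
    ∃ s' : α → ℤ, Function.Injective s' ∧ (∀ a, 0 ≤ s' a ∧ s' a < T) ∧
      Approximable σ d inp (ℓ + n) ![fun a => (s' a : ℝ) + f a] := by
  classical
  induction n generalizing T with
  | zero => exact ⟨s, hs, by simpa using hsT, h⟩
  | succ n ih =>
    have hn := hd n (by omega)
    obtain ⟨P, hP⟩ : ∃ P, (d (ℓ + 1 + n) + 1) / 2 = P + 1 := ⟨(d (ℓ + 1 + n) + 1) / 2 - 1, by omega⟩
    have hTP : T ≤ ((P + 1 : ℕ) : ℤ) * T := by push_cast; nlinarith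
    obtain ⟨s₁, hs₁, hsT₁, h₁⟩ := ih (fun i hi => hd i (by omega)) (T := ((P + 1 : ℕ) : ℤ) * T)
      (by omega) (by omega) (by
        rw [Finset.prod_range_succ, hP] at hsT
        intro a
        have := hsT a
        push_cast at this ⊢
        rw [← mul_assoc]
        exact this)
    obtain ⟨l, hl, hfold⟩ := exists_foldsBelow_blocks (S := Finset.univ.image s₁) (D := T)
      (by simpa using fun a => (hsT₁ a).1) hT
      (by rwa [Finset.card_image_of_injective _ hs₁, Finset.card_univ]) P
    obtain ⟨hinj, hrange⟩ := hfold.comp hs₁ fun a => (hsT₁ a).2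
    exact ⟨_, hinj, hrange, h₁.fold_layer hσ hf l (by
      rw [Nat.add_right_comm ℓ n 1]; omega)⟩

theorem exists_fold_halve_layers [Fintype α] (hσ : Sigmoidal σ) {f : α → ℝ}
    (hf : ∀ a, 0 ≤ f a ∧ f a < 1) {s : α → ℤ} (hs : Function.Injective s)
    (h : Approximable σ d inp ℓ ![fun a => (s a : ℝ) + f a]) (n : ℕ)
    (hd : ∀ i < n, 3 ≤ d (ℓ + 1 + i)) {D : ℤ} (hD : 0 < D) {m k : ℕ}
    (hmD : ((m * Fintype.card α : ℕ) : ℤ) < D) (hk : Fintype.card α ≤ k * m)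
    (hkn : 2 * k ≤ ∑ i ∈ Finset.range n, (d (ℓ + 1 + i) - 2))
    (hsD : ∀ a, 0 ≤ s a ∧ s a < 2 * D) :
    ∃ s' : α → ℤ, Function.Injective s' ∧ (∀ a, 0 ≤ s' a ∧ s' a < D) ∧
      Approximable σ d inp (ℓ + n) ![fun a => (s' a : ℝ) + f a] := by
  classical
  have hc : (Finset.univ.image s).card = Fintype.card α := by
    rw [Finset.card_image_of_injective _ hs, Finset.card_univ]
  obtain ⟨l, hl, hfold⟩ := exists_foldsBelow_halve (S := Finset.univ.image s) (D := D)
    (m := m) (k := k) (by simpa using fun a => (hsD a).1) hD (by rwa [hc]) (by rwa [hc])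
  obtain ⟨hinj, hrange⟩ := hfold.comp hs fun a => (hsD a).2
  refine ⟨_, hinj, hrange, ?_⟩
  -- The value is duplicated: one copy triggers the jumps, the other one is folded.
  have h1 : Approximable σ d inp ℓ ![fun a => (s a : ℝ) + f a, fun a => (s a : ℝ) + f a] :=
    h.affine (Fin.forall_fin_two.2
      ⟨⟨![1], 0, fun a => by simp⟩, ⟨![1], 0, fun a => by simp⟩⟩)
  refine (h1.accumulate_jumps hσ hf n hd l (hl.trans hkn)).affine fun _ => ⟨![0, 1], 0, fun a => ?_⟩
  simp
  ring

/-! ### Splitting into blocks and attaching codes -/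

/-- Coefficients of a step function with prescribed values. -/
theorem sum_telescope_ite (g : ℕ → ℝ) (n m : ℕ) (hm : m < n) :
    ∑ j : Fin n, (g j - if (j : ℕ) = 0 then 0 else g (j - 1)) * (if (j : ℕ) ≤ m then 1 else 0) =
      g m := by
  rw [Fin.sum_univ_eq_sum_range
    (fun j => (g j - if j = 0 then 0 else g (j - 1)) * (if j ≤ m then 1 else 0)) n]
  have hsub : Finset.range (m + 1) ⊆ Finset.range n := Finset.range_subset_range.2 hm
  rw [← Finset.sum_subset hsub fun j _ hj => by
    rw [if_neg (c := j ≤ m) (by simpa [Nat.lt_succ_iff] using hj), mul_zero]]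
  clear hsub hm
  have : ∀ k ≤ m, ∑ j ∈ Finset.range (k + 1),
      (g j - if j = 0 then 0 else g (j - 1)) * (if j ≤ m then 1 else 0) = g k := by
    intro k hk
    induction k with
    | zero => simp
    | succ k ih =>
      rw [Finset.sum_range_succ, ih (by omega)]
      simp [hk]
  exact this m le_rfl

/-- The points in blocks of length `B` from the `q + 1`-st on are moved to the block `0`, and the
values of `code` at their blocks are recorded. -/
noncomputable def blockState (B : ℕ) (code : ℕ → ℝ) (s : α → ℕ) (f : α → ℝ) (q : ℕ) :
    Fin 2 → α → ℝ :=
  ![fun a => ((if s a / B ≤ q then s a else s a % B : ℕ) : ℝ) + f a,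
    fun a => if s a / B ≤ q then 0 else code (s a / B)]

/-- Blocks are treated from the top down. Points treated earlier lie in `[0, B)`, below all later
thresholds, so they are never changed again; each of the `n` neurons treats one block. -/
theorem Approximable.blockState_layer [Finite α] (hσ : Sigmoidal σ) {s : α → ℕ} {f : α → ℝ}
    (hf : ∀ a, 0 ≤ f a ∧ f a < 1) {B : ℕ} (hB : 0 < B) {code : ℕ → ℝ} {q n : ℕ}
    (h : Approximable σ d inp ℓ (blockState B code s f (q + n))) (hn : 2 + n ≤ d (ℓ + 1)) :
    Approximable σ d inp (ℓ + 1) (blockState B code s f q) := by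
  set g₁ : ℕ → ℝ := fun m => -((q + 1 + m : ℕ) * B : ℝ) with hg₁
  set g₂ : ℕ → ℝ := fun m => code (q + 1 + m) with hg₂
  have h1 := Approximable.jump_layer_pair hσ h (n := n)
    (fun j => (((q + 1 + j : ℕ) * B : ℕ) : ℝ))
    (fun j => g₁ j - if (j : ℕ) = 0 then 0 else g₁ (j - 1))
    (fun j => g₂ j - if (j : ℕ) = 0 then 0 else g₂ (j - 1)) hn
  have hh : ∀ a, ∀ j : ℕ, heaviside (((if s a / B ≤ q + n then s a else s a % B : ℕ) : ℝ) + f a -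
      (((q + 1 + j : ℕ) * B : ℕ) : ℝ)) =
      if s a / B ≤ q + n ∧ q + 1 + j ≤ s a / B then 1 else 0 := by
    intro a j
    have := heaviside_sub_intCast ((if s a / B ≤ q + n then s a else s a % B : ℕ) : ℤ)
      (((q + 1 + j : ℕ) * B : ℕ) : ℤ) (hf a)
    rw [Int.cast_natCast, Int.cast_natCast] at this
    rw [this]
    congr 1
    rw [eq_iff_iff, Int.ofNat_le]
    split_ifs with hle
    · rw [Nat.le_div_iff_mul_le hB]
      tauto
    · have h1 := Nat.mod_lt (s a) hB
      have h2 : B ≤ (q + 1 + j) * B := by nlinarith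
      constructor
      · intro; omega
      · tauto
  have key : ∀ (g : ℕ → ℝ) a, ∑ j : Fin n, (g j - if (j : ℕ) = 0 then 0 else g (j - 1)) *
      heaviside (((if s a / B ≤ q + n then s a else s a % B : ℕ) : ℝ) + f a -
      (((q + 1 + j : ℕ) * B : ℕ) : ℝ)) =
      if s a / B ≤ q + n ∧ q < s a / B then g (s a / B - (q + 1)) else 0 := by
    intro g a
    simp only [hh]
    split_ifs with hc
    · rw [← sum_telescope_ite g n (s a / B - (q + 1)) (by omega)]
      refine Finset.sum_congr rfl fun j _ => ?_
      congr 2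
      rw [eq_iff_iff]
      omega
    · refine Finset.sum_eq_zero fun j _ => ?_
      rw [if_neg (c := s a / B ≤ q + n ∧ q + 1 + (j : ℕ) ≤ s a / B) (by omega), mul_zero]
  refine h1.congr (Fin.forall_fin_two.2 ⟨fun a => ?_, fun a => ?_⟩)
  · simp only [blockState, Matrix.cons_val_zero]
    rw [key]
    have hdm := Nat.div_add_mod (s a) B
    by_cases h1 : s a / B ≤ q
    · rw [if_pos h1, if_pos (by omega), if_neg (by omega), add_zero]
    · by_cases h2 : s a / B ≤ q + n
      · rw [if_neg h1, if_pos h2, if_pos (by omega)]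
        simp only [hg₁]
        rw [show q + 1 + (s a / B - (q + 1)) = s a / B by omega]
        have h3 : (B : ℝ) * (s a / B : ℕ) + (s a % B : ℕ) = s a := by exact_mod_cast hdm
        linarith
      · rw [if_neg h1, if_neg h2, if_neg (by omega), add_zero]
  · simp only [blockState, Matrix.cons_val_one, Matrix.cons_val_zero]
    rw [key]
    by_cases h1 : s a / B ≤ q
    · rw [if_pos h1, if_pos (by omega), if_neg (by omega), add_zero]
    · by_cases h2 : s a / B ≤ q + n
      · rw [if_neg h1, if_pos h2, if_pos (by omega)]
        simp only [hg₂]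
        rw [show q + 1 + (s a / B - (q + 1)) = s a / B by omega, zero_add]
      · rw [if_neg h1, if_neg h2, if_neg (by omega), add_zero]

theorem Approximable.split_blocks [Finite α] (hσ : Sigmoidal σ) {s : α → ℕ} {f : α → ℝ}
    (hf : ∀ a, 0 ≤ f a ∧ f a < 1) {B : ℕ} (hB : 0 < B) (code : ℕ → ℝ)
    (h : Approximable σ d inp ℓ ![fun a => (s a : ℝ) + f a]) (n : ℕ)
    (hd : ∀ i < n, 3 ≤ d (ℓ + 1 + i))
    (hs : ∀ a, s a < (∑ i ∈ Finset.range n, (d (ℓ + 1 + i) - 2)) * B) :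
    Approximable σ d inp (ℓ + n)
      ![fun a => ((s a % B : ℕ) : ℝ) + f a, fun a => code (s a / B)] := by
  set A := ∑ i ∈ Finset.range n, (d (ℓ + 1 + i) - 2)
  -- Block `0` triggers no jump, so codes are taken relative to its code, which is added back at the
  -- end.
  set code' : ℕ → ℝ := fun j => code j - code 0
  have h0 : Approximable σ d inp ℓ (blockState B code' s f A) :=
    h.affine (Fin.forall_fin_two.2 ⟨⟨![1], 0, fun a => ?_⟩, ⟨![0], 0, fun a => ?_⟩⟩)
  · have key : ∀ k ≤ n, Approximable σ d inp (ℓ + k) (blockState B code' s f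
        (A - ∑ i ∈ Finset.range k, (d (ℓ + 1 + i) - 2))) := by
      intro k hk
      induction k with
      | zero => simpa using h0
      | succ k ih =>
        have hle : ∑ i ∈ Finset.range (k + 1), (d (ℓ + 1 + i) - 2) ≤ A :=
          Finset.sum_le_sum_of_subset (Finset.range_subset_range.2 hk)
        have h3 := hd k (by omega)
        rw [Finset.sum_range_succ] at hle ⊢
        refine Approximable.blockState_layer (n := d (ℓ + 1 + k) - 2) hσ hf hB ?_ (by
          have : d (ℓ + k + 1) = d (ℓ + 1 + k) := by rw [Nat.add_right_comm ℓ k 1]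
          change _ ≤ d (ℓ + k + 1)
          omega)
        rw [Nat.sub_add_eq, Nat.sub_add_cancel (by omega)]
        exact ih (by omega)
    have hfin := key n le_rfl
    rw [Nat.sub_self] at hfin
    refine hfin.affine (Fin.forall_fin_two.2
      ⟨⟨![1, 0], 0, fun a => ?_⟩, ⟨![0, 1], code 0, fun a => ?_⟩⟩)
    · simp only [blockState, Fin.sum_univ_two, Matrix.cons_val_zero, Matrix.cons_val_one]
      split_ifs with hq
      · rw [Nat.mod_eq_of_lt ((Nat.div_eq_zero_iff_lt hB).1 (Nat.le_zero.1 hq))]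
        ring
      · ring
    · simp only [blockState, Fin.sum_univ_two, Matrix.cons_val_zero, Matrix.cons_val_one]
      split_ifs with hq
      · rw [Nat.le_zero.1 hq]
        ring
      · simp only [code']
        ring
  · have : s a / B ≤ A := (Nat.div_lt_of_lt_mul (by rw [mul_comm]; exact hs a)).le
    simp [blockState, this]
  · have : s a / B ≤ A := (Nat.div_lt_of_lt_mul (by rw [mul_comm]; exact hs a)).le
    simp [blockState, this]

/-! ### Reading labels bit by bit -/

/-- Two layers strip `q` off a value `w` which is at least `q`; simultaneously, the value `v`
decreases by `m` where it is below `1`. -/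
theorem Approximable.read_bit [Finite α] (hσ : Sigmoidal σ) {v w : α → ℝ}
    (h : Approximable σ d inp ℓ ![v, w]) (q m : ℝ) (h₁ : 3 ≤ d (ℓ + 1)) (h₂ : 3 ≤ d (ℓ + 2)) :
    Approximable σ d inp (ℓ + 2) ![fun a => if q ≤ w a ∧ v a < 1 then v a - m else v a,
      fun a => if q ≤ w a then w a - q else w a] := by
  obtain ⟨R, hR⟩ : ∃ R : ℝ, ∀ a, |v a| ≤ R := by
    obtain ⟨R, hR⟩ := (Set.finite_range v).isBounded.exists_norm_le
    exact ⟨R, fun a => hR _ ⟨a, rfl⟩⟩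
  have h1 := h.layer_of_affine hσ (P := ![v, w]) (n := 1) (Q := fun _ a => w a - q)
    (Fin.forall_fin_two.2 ⟨⟨![1, 0], 0, fun a => by simp⟩, ⟨![0, 1], 0, fun a => by simp⟩⟩)
    (fun _ => ⟨![0, 1], -q, fun a => by simp; ring⟩) (by simpa using h₁)
  -- The added neuron is a gate. If the bit is absent, the term `1 + R` forces its value to `1`; if
  -- the bit is present, it tests `1 ≤ v`. It vanishes exactly when `q ≤ w` and `v < 1`.
  have h2 := h1.layer_of_affine hσ (P := ![v, fun a => w a - q * heaviside (w a - q)]) (n := 1)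
    (Q := fun _ a => v a - 1 + (1 + R) * (1 - heaviside (w a - q)))
    (Fin.forall_fin_two.2 ⟨⟨Sum.elim ![1, 0] 0, 0, fun a => by simp⟩,
      ⟨Sum.elim ![0, 1] fun _ => -q, 0, fun a => by simp; ring⟩⟩)
    (fun _ => ⟨Sum.elim ![1, 0] fun _ => -(1 + R), R, fun a => by simp; ring⟩) (by simpa using h₂)
  refine h2.affine (Fin.forall_fin_two.2 ⟨⟨Sum.elim ![1, 0] fun _ => m, -m, fun a => ?_⟩,
    ⟨Sum.elim ![0, 1] 0, 0, fun a => ?_⟩⟩)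
  · have hv := (abs_le.1 (hR a)).1
    simp only [Matrix.cons_val_zero, Fintype.sum_sum_type, Sum.elim_inl, Sum.elim_inr,
      Fin.sum_univ_two, Matrix.cons_val_one, Finset.univ_unique, Finset.sum_singleton]
    by_cases hq : q ≤ w a
    · simp only [heaviside, sub_nonneg, hq, if_true, true_and, sub_self, mul_zero, add_zero]
      by_cases hv1 : v a < 1
      · rw [if_pos hv1, if_neg (not_le.2 hv1)]; ring
      · rw [if_neg hv1, if_pos (not_lt.1 hv1)]; ring
    · simp only [heaviside, sub_nonneg, hq, if_false, false_and, sub_zero, mul_one]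
      rw [if_pos (by linarith)]
      ring
  · simp only [Matrix.cons_val_zero, Fintype.sum_sum_type, Sum.elim_inl, Sum.elim_inr,
      Fin.sum_univ_two, Matrix.cons_val_one, Finset.univ_unique, Finset.sum_singleton]
    simp only [heaviside, sub_nonneg]
    split_ifs <;> simp

/-- One layer marks the positions which have been reached. -/
theorem Approximable.next_position [Finite α] (hσ : Sigmoidal σ) {v w : α → ℝ}
    (h : Approximable σ d inp ℓ ![v, w]) (m : ℝ) (h₁ : 3 ≤ d (ℓ + 1)) :
    Approximable σ d inp (ℓ + 1) ![fun a => if v a < 1 then v a - 1 + m else v a - 1, w] := by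
  have h1 := h.layer_of_affine hσ (P := ![v, w]) (n := 1) (Q := fun _ a => v a - 1)
    (Fin.forall_fin_two.2 ⟨⟨![1, 0], 0, fun a => by simp⟩, ⟨![0, 1], 0, fun a => by simp⟩⟩)
    (fun _ => ⟨![1, 0], -1, fun a => by simp; ring⟩) (by simpa using h₁)
  refine h1.affine (Fin.forall_fin_two.2 ⟨⟨Sum.elim ![1, 0] fun _ => -m, m - 1, fun a => ?_⟩,
    ⟨Sum.elim ![0, 1] 0, 0, fun a => by simp⟩⟩)
  simp only [Matrix.cons_val_zero, Fintype.sum_sum_type, Sum.elim_inl, Sum.elim_inr,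
    Fin.sum_univ_two, Matrix.cons_val_one, Finset.univ_unique, Finset.sum_singleton, heaviside,
    sub_nonneg]
  by_cases hv1 : v a < 1
  · rw [if_pos hv1, if_neg (not_le.2 hv1)]; ring
  · rw [if_neg hv1, if_pos (not_lt.1 hv1)]; ring

/-- The condition `v < 1` marks the points whose label is being read. As `M ≥ 0`, subtracting bits
keeps it true, so all `c` bits are read by the same points. -/
theorem Approximable.read_bits [Finite α] (hσ : Sigmoidal σ) (c n : ℕ) {M : ℝ} (hM : 0 ≤ M)
    {v : α → ℝ} {lab R : α → ℕ} (hlab : ∀ a, lab a < 2 ^ c) (hR : ∀ a, R a < 2 ^ n)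
    (h : Approximable σ d inp ℓ ![v, fun a => ((lab a * 2 ^ n + R a : ℕ) : ℝ)])
    (hd : ∀ i < 2 * c, 3 ≤ d (ℓ + 1 + i)) :
    Approximable σ d inp (ℓ + 2 * c)
      ![fun a => if v a < 1 then v a - M * lab a else v a, fun a => (R a : ℝ)] := by
  induction c generalizing n M lab R with
  | zero =>
    have h0 : ∀ a, lab a = 0 := fun a => by simpa using hlab a
    simpa [h0] using h
  | succ c ih =>
    have hw : ∀ a, lab a * 2 ^ n + R a =
        lab a / 2 * 2 ^ (n + 1) + (lab a % 2 * 2 ^ n + R a) := fun a => by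
      conv_lhs => rw [← Nat.div_add_mod (lab a) 2]
      ring
    -- The leading bits are read first, with doubled weight; the lowest bit of `lab` comes last and
    -- has weight `M`.
    have h1 := ih (n := n + 1) (M := 2 * M) (by positivity) (lab := fun a => lab a / 2)
      (R := fun a => lab a % 2 * 2 ^ n + R a)
      (fun a => by have := hlab a; rw [pow_succ] at this; omega)
      (fun a => by
        have h1 := hR a
        have h2 : lab a % 2 * 2 ^ n ≤ 1 * 2 ^ n :=
          Nat.mul_le_mul_right _ (by omega)
        rw [pow_succ]; omega)
      (by simpa only [hw] using h) (fun i hi => hd i (by omega))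
    have e1 : ℓ + 1 + 2 * c = ℓ + 2 * c + 1 := by omega
    have e2 : ℓ + 1 + (2 * c + 1) = ℓ + 2 * c + 2 := by omega
    have h2 := h1.read_bit hσ (2 ^ n) M (e1 ▸ hd (2 * c) (by omega))
      (e2 ▸ hd (2 * c + 1) (by omega))
    refine h2.congr (Fin.forall_fin_two.2 ⟨fun a => ?_, fun a => ?_⟩)
    · simp only [Matrix.cons_val_zero]
      have hb : (lab a : ℝ) = 2 * (lab a / 2 : ℕ) + (lab a % 2 : ℕ) := by
        exact_mod_cast (Nat.div_add_mod (lab a) 2).symm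
      have hnn : 0 ≤ 2 * M * ((lab a / 2 : ℕ) : ℝ) := by positivity
      rcases Nat.mod_two_eq_zero_or_one (lab a) with h0 | h0
      · have hlt : ((R a : ℕ) : ℝ) < 2 ^ n := by exact_mod_cast hR a
        simp only [h0, zero_mul, zero_add, not_le.2 hlt, false_and, if_false]
        rw [h0, Nat.cast_zero, add_zero] at hb
        rw [hb]
        split_ifs <;> ring
      · have hle : (2 ^ n : ℝ) ≤ ((1 * 2 ^ n + R a : ℕ) : ℝ) := by
          push_cast
          have : (0 : ℝ) ≤ R a := by positivity
          linarith
        simp only [h0, hle, true_and]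
        rw [h0, Nat.cast_one] at hb
        rw [hb]
        by_cases hv : v a < 1
        · rw [if_pos hv, if_pos hv, if_pos (by linarith)]
          ring
        · rw [if_neg hv, if_neg hv, if_neg hv]
    · simp only [Matrix.cons_val_one, Matrix.cons_val_zero]
      rcases Nat.mod_two_eq_zero_or_one (lab a) with h0 | h0
      · have hlt : ((R a : ℕ) : ℝ) < 2 ^ n := by exact_mod_cast hR a
        simp only [h0, zero_mul, zero_add, not_le.2 hlt, if_false]
      · have hle : (2 ^ n : ℝ) ≤ ((1 * 2 ^ n + R a : ℕ) : ℝ) := by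
          push_cast
          have : (0 : ℝ) ≤ R a := by positivity
          linarith
        simp only [h0, hle, if_true]
        push_cast
        ring

/-- The number whose `c`-bit digits are the entries of `tab` at the positions `p, …, B - 1`. -/
def encode (c B : ℕ) (tab : ℕ → ℕ) (p : ℕ) : ℕ :=
  ∑ i ∈ Finset.Ico p B, tab i * 2 ^ (c * (B - 1 - i))

theorem encode_eq {c B p : ℕ} (tab : ℕ → ℕ) (hp : p < B) :
    encode c B tab p = tab p * 2 ^ (c * (B - 1 - p)) + encode c B tab (p + 1) :=
  Finset.sum_eq_sum_Ico_succ_bot hp _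

theorem encode_lt {c B : ℕ} {tab : ℕ → ℕ} (htab : ∀ i, tab i < 2 ^ c) (k : ℕ) :
    ∀ p, p + k = B → encode c B tab p < 2 ^ (c * k) := by
  induction k with
  | zero =>
    intro p hp
    simp [encode, ← hp]
  | succ k ih =>
    intro p hp
    rw [encode_eq tab (by omega), show B - 1 - p = k by omega, Nat.mul_succ, pow_add]
    have h1 := ih (p + 1) (by omega)
    have h2 : (tab p + 1) * 2 ^ (c * k) ≤ 2 ^ c * 2 ^ (c * k) := Nat.mul_le_mul_right _ (htab p)
    rw [mul_comm (2 ^ (c * k))]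
    linarith

/-- The state before position `p` is processed: points at positions below `p` have their labels
written to the first value, and the others count down to their positions. -/
noncomputable def readerState (c B : ℕ) (M Q : ℝ) (pos : α → ℕ) (f : α → ℝ) (tab : α → ℕ → ℕ)
    (p : ℕ) : Fin 2 → α → ℝ :=
  ![fun a => if p ≤ pos a then (pos a : ℝ) - p + f a
    else (pos a : ℝ) - p + f a + Q - M * tab a (pos a), fun a => (encode c B (tab a) p : ℝ)]

/-- A point is active precisely when `p = pos a`, its first value then being `f a < 1`. After
reading, `Q` lifts it so high that neither the subtracted label nor the remaining countdown brings
it below `1` while positions are still being processed. -/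
theorem Approximable.readerState_succ [Finite α] (hσ : Sigmoidal σ) {c B : ℕ} {M Q : ℝ}
    (hM : 0 ≤ M) (hQ : M * 2 ^ c + B + 1 ≤ Q) {pos : α → ℕ} {f : α → ℝ}
    (hf : ∀ a, 0 ≤ f a ∧ f a < 1) {tab : α → ℕ → ℕ} (htab : ∀ a i, tab a i < 2 ^ c) {p : ℕ}
    (hp : p < B) (h : Approximable σ d inp ℓ (readerState c B M Q pos f tab p))
    (hd : ∀ i < 2 * c + 1, 3 ≤ d (ℓ + 1 + i)) :
    Approximable σ d inp (ℓ + (2 * c + 1)) (readerState c B M Q pos f tab (p + 1)) := by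
  have h0 := h.congr (G := ![readerState c B M Q pos f tab p 0, fun a => ((tab a p * 2 ^ (c * (B - 1 - p)) +
    encode c B (tab a) (p + 1) : ℕ) : ℝ)]) (Fin.forall_fin_two.2 ⟨fun a => by simp, fun a => by
      simp only [readerState, Matrix.cons_val_one, Matrix.cons_val_zero]
      rw [encode_eq _ hp]⟩)
  have hlt : ∀ a, encode c B (tab a) (p + 1) < 2 ^ (c * (B - 1 - p)) := fun a =>
    encode_lt (htab a) (B - 1 - p) (p + 1) (by omega)
  have h1 := h0.read_bits hσ c (c * (B - 1 - p)) hM (fun a => htab a p) hlt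
    (fun i hi => hd i (by omega))
  have e1 : ℓ + 1 + 2 * c = ℓ + 2 * c + 1 := by omega
  refine (h1.next_position hσ Q (e1 ▸ hd (2 * c) (by omega))).congr
    (Fin.forall_fin_two.2 ⟨fun a => ?_, fun a => by simp [readerState]⟩)
  obtain ⟨hf0, hf1⟩ := hf a
  have hM' : M * tab a (pos a) ≤ M * 2 ^ c :=
    mul_le_mul_of_nonneg_left (by exact_mod_cast (htab a _).le) hM
  have hM0 : 0 ≤ M * tab a p := by positivity
  have hpB : (p : ℝ) ≤ B := by exact_mod_cast hp.le
  have hpos0 : (0 : ℝ) ≤ pos a := by positivity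
  have hp1 : readerState c B M Q pos f tab (p + 1) 0 a = if p + 1 ≤ pos a then
      (pos a : ℝ) - (p + 1) + f a else (pos a : ℝ) - (p + 1) + f a + Q - M * tab a (pos a) := by
    simp [readerState]
  have hp0 : readerState c B M Q pos f tab p 0 a = if p ≤ pos a then
      (pos a : ℝ) - p + f a else (pos a : ℝ) - p + f a + Q - M * tab a (pos a) := by
    simp [readerState]
  simp only [hp1, Matrix.cons_val_zero]
  generalize readerState c B M Q pos f tab p 0 a = v at hp0
  rcases lt_trichotomy p (pos a) with hlt | heq | hgt
  · have h2 : (p : ℝ) + 1 ≤ pos a := by exact_mod_cast hlt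
    rw [if_pos hlt.le] at hp0
    have hv : ¬ v < 1 := not_lt.2 (by linarith)
    rw [if_pos (show p + 1 ≤ pos a from hlt), if_neg hv, if_neg hv]
    linarith
  · rw [if_pos heq.le] at hp0
    have hpr : (p : ℝ) = pos a := by exact_mod_cast heq
    have hv : v < 1 := by linarith
    rw [if_neg (by omega : ¬ p + 1 ≤ pos a), if_pos hv, if_pos (by linarith), ← heq]
    linarith
  · rw [if_neg (by omega)] at hp0
    have hv : ¬ v < 1 := not_lt.2 (by linarith)
    rw [if_neg (by omega : ¬ p + 1 ≤ pos a), if_neg hv, if_neg hv]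
    linarith

/-- Given its position `pos a` and the encoded table of its block, the label of every point can be
computed by `2 c + 1` layers for each position. -/
theorem Approximable.decode [Finite α] (hσ : Sigmoidal σ) {c B : ℕ} {pos : α → ℕ} {f : α → ℝ}
    (hf : ∀ a, 0 ≤ f a ∧ f a < 1) (hpos : ∀ a, pos a < B) {tab : α → ℕ → ℕ}
    (htab : ∀ a i, tab a i < 2 ^ c)
    (h : Approximable σ d inp ℓ ![fun a => (pos a : ℝ) + f a, fun a => (encode c B (tab a) 0 : ℝ)])
    (hd : ∀ i < B * (2 * c + 1), 3 ≤ d (ℓ + 1 + i)) {ε : ℝ} (hε : 0 < ε) :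
    ∃ x : α → ℝ, Approximable σ d inp (ℓ + B * (2 * c + 1)) ![x] ∧
      ∀ a, |x a - tab a (pos a)| ≤ ε := by
  -- In the end the label appears multiplied by `M`, next to a remainder `B - pos a - f a` between
  -- `0` and `B`; dividing by `M` makes the remainder smaller than `ε`.
  set M : ℝ := (B + 1) / ε
  have hM : 0 < M := by positivity
  set Q : ℝ := M * 2 ^ c + B + 1
  have key : ∀ p ≤ B, Approximable σ d inp (ℓ + p * (2 * c + 1))
      (readerState c B M Q pos f tab p) := by
    intro p hp
    induction p with
    | zero =>
      rw [zero_mul]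
      exact h.congr (Fin.forall_fin_two.2 ⟨fun a => by simp [readerState],
        fun a => by simp [readerState]⟩)
    | succ p ih =>
      have h1 := (ih (by omega)).readerState_succ hσ hM.le le_rfl hf htab (by omega)
        (fun i hi => by
          have h2 : (p + 1) * (2 * c + 1) ≤ B * (2 * c + 1) := Nat.mul_le_mul_right _ hp
          rw [add_mul] at h2
          have := hd (p * (2 * c + 1) + i) (by omega)
          rwa [show ℓ + 1 + (p * (2 * c + 1) + i) = ℓ + p * (2 * c + 1) + 1 + i by omega] at this)
      rwa [add_assoc, ← Nat.succ_mul] at h1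
  refine ⟨fun a => (Q - ((pos a : ℝ) - B + f a + Q - M * tab a (pos a))) / M,
    (key B le_rfl).affine fun _ => ⟨![-1 / M, 0], Q / M, fun a => ?_⟩, fun a => ?_⟩
  · simp only [readerState, Fin.sum_univ_two, Matrix.cons_val_zero, Matrix.cons_val_one,
      Matrix.cons_val_fin_one]
    rw [if_neg (not_le.2 (hpos a))]
    ring
  · have h1 : (Q - ((pos a : ℝ) - B + f a + Q - M * tab a (pos a))) / M - tab a (pos a) =
        (B - pos a - f a) / M := by
      field_simp
      ring
    have h2 : (pos a : ℝ) + 1 ≤ B := by exact_mod_cast hpos a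
    have h3 : (0 : ℝ) ≤ pos a := by positivity
    obtain ⟨hf0, hf1⟩ := hf a
    rw [h1, abs_div, abs_of_pos hM, div_le_iff₀ hM, abs_of_nonneg (by linarith)]
    have : ε * M = B + 1 := by simp only [M]; field_simp
    linarith

/-! ### Projection to a line -/

open MeasureTheory in
theorem volume_sum_sq_lt_one_le (m : ℕ) :
    volume {g : Fin m → ℝ | ∑ i, g i ^ 2 < 1} ≤
      ENNReal.ofReal (√Real.pi ^ m / Real.Gamma (m / 2 + 1)) := by
  rcases m with _ | m
  -- Dimension `0` is treated by hand: the whole space is a point of volume `1`.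
  · refine (measure_mono (Set.subset_univ _)).trans ?_
    rw [MeasureTheory.volume_pi, Measure.pi_of_empty _ (0 : Fin 0 → ℝ)]
    simp
  · have h := EuclideanSpace.volume_ball (Fin (m + 1)) 0 1
    rw [ENNReal.ofReal_one, one_pow, one_mul, Fintype.card_fin] at h
    rw [← h, ← (PiLp.volume_preserving_toLp (Fin (m + 1))).measure_preimage
      measurableSet_ball.nullMeasurableSet]
    refine measure_mono fun g hg => ?_
    simp only [Set.mem_preimage, mem_ball_zero_iff, EuclideanSpace.norm_eq, Real.norm_eq_abs, sq_abs]
    rw [Real.sqrt_lt' one_pos, one_pow]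
    exact hg

open MeasureTheory in
/-- The volume of a slab of the unit ball. -/
theorem volume_slab_le {m : ℕ} {e : EuclideanSpace ℝ (Fin (m + 1))} (he : ‖e‖ = 1) (t : ℝ) :
    volume {u ∈ Metric.ball (0 : EuclideanSpace ℝ (Fin (m + 1))) 1 | |inner ℝ e u| < t} ≤
      ENNReal.ofReal (2 * t) * ENNReal.ofReal (√Real.pi ^ m / Real.Gamma (m / 2 + 1)) := by
  obtain ⟨b, hb⟩ : ∃ b : OrthonormalBasis (Fin (m + 1)) ℝ (EuclideanSpace ℝ (Fin (m + 1))),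
      b 0 = e := by
    have horth : Orthonormal ℝ (({0} : Set (Fin (m + 1))).domRestrict fun _ => e) :=
      ⟨fun _ => he, fun i j hij => absurd (Subsingleton.elim i j) hij⟩
    obtain ⟨b, hb⟩ := horth.exists_orthonormalBasis_extension_of_card_eq (by simp)
    exact ⟨b, hb 0 rfl⟩
  set G : Set (Fin m → ℝ) := {g | ∑ i, g i ^ 2 < 1}
  have hG : MeasurableSet G := measurableSet_lt (by fun_prop) measurable_const
  have hmp := ((volume_preserving_piFinSuccAbove (fun _ : Fin (m + 1) => ℝ) 0).comp
    (PiLp.volume_preserving_ofLp (Fin (m + 1)))).comp b.measurePreserving_repr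
  have hle : volume {u ∈ Metric.ball (0 : EuclideanSpace ℝ (Fin (m + 1))) 1 | |inner ℝ e u| < t} ≤
      volume (Set.Ioo (-t) t ×ˢ G) := by
    rw [← hmp.measure_preimage (measurableSet_Ioo.prod hG).nullMeasurableSet]
    refine measure_mono fun u hu => ?_
    have h1 : ‖b.repr u‖ < 1 := by simpa using hu.1
    rw [EuclideanSpace.norm_eq, Real.sqrt_lt' one_pos, one_pow, Fin.sum_univ_succ] at h1
    simp only [Real.norm_eq_abs, sq_abs] at h1
    have h2 : |b.repr u 0| < t := by
      rw [b.repr_apply_apply, hb]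
      exact hu.2
    refine ⟨abs_lt.1 h2, ?_⟩
    have h3 := sq_nonneg (b.repr u 0)
    change ∑ i : Fin m, (b.repr u (Fin.succ i)) ^ 2 < 1
    linarith
  refine hle.trans ?_
  rw [Measure.volume_eq_prod, Measure.prod_prod, Real.volume_Ioo]
  gcongr
  · exact (by ring : t - -t = 2 * t).le
  · exact volume_sum_sq_lt_one_le m

/-- Logarithmic convexity of `Γ` at the midpoint of `x` and `x + 1`. It bounds the ratio of the
volumes of unit balls in consecutive dimensions. -/
theorem Gamma_add_half_le {x : ℝ} (hx : 0 < x) :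
    Real.Gamma (x + 1 / 2) ≤ √x * Real.Gamma x := by
  have h := Real.Gamma_mul_add_mul_le_rpow_Gamma_mul_rpow_Gamma hx (t := x + 1) (by linarith)
    (a := 1 / 2) (b := 1 / 2) (by norm_num) (by norm_num) (by norm_num)
  rw [show 1 / 2 * x + 1 / 2 * (x + 1) = x + 1 / 2 by ring, Real.Gamma_add_one hx.ne',
    ← Real.sqrt_eq_rpow, ← Real.sqrt_eq_rpow, Real.sqrt_mul hx.le] at h
  have hG := (Real.Gamma_pos_of_pos hx).le
  calc _ ≤ _ := h
    _ = √x * (√(Real.Gamma x) * √(Real.Gamma x)) := by ring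
    _ = _ := by rw [Real.mul_self_sqrt hG]

theorem two_mul_card_lt_le (N : ℕ) :
    2 * (Finset.univ.filter fun q : Fin N × Fin N => q.1 < q.2).card ≤ N ^ 2 := by
  have h1 : (Finset.univ.filter fun q : Fin N × Fin N => q.2 < q.1).card =
      (Finset.univ.filter fun q : Fin N × Fin N => q.1 < q.2).card :=
    Finset.card_bij' (fun q _ => q.swap) (fun q _ => q.swap) (by simp) (by simp) (by simp) (by simp)
  have h2 : Disjoint (Finset.univ.filter fun q : Fin N × Fin N => q.1 < q.2)
      (Finset.univ.filter fun q : Fin N × Fin N => q.2 < q.1) :=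
    Finset.disjoint_filter.2 fun q _ h h' => lt_asymm h h'
  have h3 := Finset.card_le_univ ((Finset.univ.filter fun q : Fin N × Fin N => q.1 < q.2) ∪
    (Finset.univ.filter fun q : Fin N × Fin N => q.2 < q.1))
  rw [Finset.card_union_of_disjoint h2, h1, Fintype.card_prod, Fintype.card_fin] at h3
  rw [sq]
  omega

open MeasureTheory in
/-- Some direction does not shrink the distances of `N` points in dimension `n` by more than a
factor of order `N ^ 2 √n`. -/
theorem exists_direction {N m : ℕ} (hN : 0 < N) {p : Fin N → EuclideanSpace ℝ (Fin (m + 1))}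
    (hp : Function.Injective p) :
    ∃ u : EuclideanSpace ℝ (Fin (m + 1)), ‖u‖ ≤ 1 ∧ ∀ i j,
      √(8 / (Real.pi * (m + 1))) / N ^ 2 * dist (p i) (p j) ≤ |inner ℝ u (p i - p j)| := by
  set t := √(8 / (Real.pi * (m + 1))) / N ^ 2 with ht
  have hπ := Real.pi_pos
  have hN' : (0 : ℝ) < N := by exact_mod_cast hN
  have ht0 : 0 < t := by positivity
  set V := √Real.pi ^ m / Real.Gamma (m / 2 + 1) with hV
  set P := Finset.univ.filter fun q : Fin N × Fin N => q.1 < q.2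
  set slab : Fin N × Fin N → Set (EuclideanSpace ℝ (Fin (m + 1))) := fun q =>
    {u ∈ Metric.ball (0 : EuclideanSpace ℝ (Fin (m + 1))) 1 |
      |inner ℝ (‖p q.1 - p q.2‖⁻¹ • (p q.1 - p q.2)) u| < t}
  have hΓ : 0 < Real.Gamma ((m : ℝ) / 2 + 1) := Real.Gamma_pos_of_pos (by positivity)
  have hΓ' : 0 < Real.Gamma (((m + 1 : ℕ) : ℝ) / 2 + 1) := Real.Gamma_pos_of_pos (by positivity)
  have hV0 : 0 < V := by positivity
  have hunion : volume (⋃ q ∈ P, slab q) ≤ ENNReal.ofReal (N ^ 2 * t * V) := by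
    refine (measure_biUnion_finset_le _ _).trans ?_
    calc ∑ q ∈ P, volume (slab q) ≤ ∑ q ∈ P, ENNReal.ofReal (2 * t * V) := by
          refine Finset.sum_le_sum fun q hq => ?_
          rw [ENNReal.ofReal_mul (by positivity)]
          refine volume_slab_le ?_ t
          have : p q.1 - p q.2 ≠ 0 := sub_ne_zero.2 (hp.ne (Finset.mem_filter.1 hq).2.ne)
          rw [norm_smul, norm_inv, norm_norm, inv_mul_cancel₀ (norm_ne_zero_iff.2 this)]
      _ = ENNReal.ofReal (P.card * (2 * t * V)) := by
          rw [Finset.sum_const, nsmul_eq_mul, ENNReal.ofReal_mul (p := (P.card : ℝ)) (by positivity),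
            ENNReal.ofReal_natCast]
      _ ≤ ENNReal.ofReal (N ^ 2 * t * V) := by
          apply ENNReal.ofReal_le_ofReal
          have h1 : (2 : ℝ) * P.card ≤ N ^ 2 := by exact_mod_cast two_mul_card_lt_le N
          have h2 : 0 < t * V := by positivity
          nlinarith
  have hlt : (N : ℝ) ^ 2 * t * V <
      √Real.pi ^ (m + 1) / Real.Gamma (((m + 1 : ℕ) : ℝ) / 2 + 1) := by
    have h1 : (N : ℝ) ^ 2 * t = √(8 / (Real.pi * (m + 1))) := by
      rw [ht]; field_simp
    rw [h1, lt_div_iff₀ hΓ']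
    have h2 := Gamma_add_half_le (x := (m : ℝ) / 2 + 1) (by positivity)
    rw [show (m : ℝ) / 2 + 1 + 1 / 2 = ((m + 1 : ℕ) : ℝ) / 2 + 1 by push_cast; ring] at h2
    -- This is what makes the slabs too small to cover the ball. It reduces to `4 m + 8 < π² (m +
    -- 1)`, which holds since `π² > 9`.
    have h3 : √(8 / (Real.pi * (m + 1))) * √((m : ℝ) / 2 + 1) < √Real.pi := by
      rw [← Real.sqrt_mul (by positivity)]
      apply Real.sqrt_lt_sqrt (by positivity)
      rw [div_mul_eq_mul_div, div_lt_iff₀ (by positivity)]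
      have h4 : 9 < Real.pi * Real.pi := by nlinarith [Real.pi_gt_three]
      have h5 : (0 : ℝ) ≤ m := by positivity
      nlinarith
    calc √(8 / (Real.pi * (m + 1))) * V * Real.Gamma (((m + 1 : ℕ) : ℝ) / 2 + 1)
        ≤ √(8 / (Real.pi * (m + 1))) * V * (√((m : ℝ) / 2 + 1) * Real.Gamma ((m : ℝ) / 2 + 1)) := by
          gcongr
      _ = √(8 / (Real.pi * (m + 1))) * √((m : ℝ) / 2 + 1) * √Real.pi ^ m := by
          rw [hV]; field_simp
      _ < √Real.pi * √Real.pi ^ m := by gcongr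
      _ = √Real.pi ^ (m + 1) := by ring
  have hball := EuclideanSpace.volume_ball (Fin (m + 1)) 0 1
  rw [ENNReal.ofReal_one, one_pow, one_mul, Fintype.card_fin] at hball
  obtain ⟨u, hu, hu'⟩ : ∃ u ∈ Metric.ball (0 : EuclideanSpace ℝ (Fin (m + 1))) 1,
      u ∉ ⋃ q ∈ P, slab q := by
    by_contra! hcon
    have h1 := measure_mono (μ := volume) (show Metric.ball (0 : EuclideanSpace ℝ (Fin (m + 1))) 1 ⊆
      _ from hcon)
    rw [hball] at h1
    exact absurd (h1.trans hunion) (not_le.2 ((ENNReal.ofReal_lt_ofReal_iff (by positivity)).2 hlt))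
  have main : ∀ i j, i < j → t * dist (p i) (p j) ≤ |inner ℝ u (p i - p j)| := by
    intro i j hij
    by_contra! hcon
    apply hu'
    rw [Set.mem_iUnion₂]
    refine ⟨(i, j), by simp [P, hij], hu, ?_⟩
    have : 0 < ‖p i - p j‖ := norm_pos_iff.2 (sub_ne_zero.2 (hp.ne hij.ne))
    rw [real_inner_smul_left, abs_mul, abs_of_pos (inv_pos.2 this), real_inner_comm,
      inv_mul_lt_iff₀ this, mul_comm, ← dist_eq_norm]
    exact hcon
  refine ⟨u, (mem_ball_zero_iff.1 hu).le, fun i j => ?_⟩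
  rcases lt_trichotomy i j with hij | rfl | hij
  · exact main i j hij
  · simp
  · rw [dist_comm, ← abs_neg, ← inner_neg_right, neg_sub]
    exact main j i hij

theorem Separated.dist_le {n : ℕ} {Δ : ℝ} (hΔ : 0 ≤ Δ) {X : Set (EuclideanSpace ℝ (Fin n))}
    (h : Separated Δ X) {x x' p p' : EuclideanSpace ℝ (Fin n)} (hx : x ∈ X) (hx' : x' ∈ X)
    (hp : p ∈ X) (hp' : p' ∈ X) (hpp : p ≠ p') : dist x x' ≤ Δ * dist p p' := by
  by_cases hxx : x = x'
  · rw [hxx, dist_self]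
    positivity
  have h1 : edist x x' ≤ ⨆ (x ∈ X) (x' ∈ X) (_ : x ≠ x'), edist x x' :=
    le_iSup₂_of_le x hx (le_iSup₂_of_le x' hx' (le_iSup_of_le hxx le_rfl))
  have h2 : (⨅ (x ∈ X) (x' ∈ X) (_ : x ≠ x'), edist x x') ≤ edist p p' :=
    iInf₂_le_of_le p hp (iInf₂_le_of_le p' hp' (iInf_le_of_le hpp le_rfl))
  have h3 : edist x x' ≤ ENNReal.ofReal Δ * edist p p' := (h1.trans h.le).trans (by gcongr)
  rw [edist_dist, edist_dist, ← ENNReal.ofReal_mul hΔ] at h3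
  exact (ENNReal.ofReal_le_ofReal_iff (by positivity)).1 h3

/-- A separated set is projected to a line so that its points get distances at least `1`. -/
theorem Separated.exists_projection {n N : ℕ} (hN : 2 ≤ N) {Δ : ℝ} (hΔ : 0 ≤ Δ)
    {X : Set (EuclideanSpace ℝ (Fin n))} (hXfin : X.Finite) (hX : X.ncard = N)
    (h : Separated Δ X) :
    ∃ (A : Fin n → ℝ) (c : ℝ),
      (∀ x ∈ X, 0 ≤ ∑ j, A j * x j + c ∧
        ∑ j, A j * x j + c ≤ Δ * √(2 * Real.pi * n) * (N ^ 2 / 4)) ∧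
      ∀ x ∈ X, ∀ x' ∈ X, x ≠ x' → 1 ≤ |(∑ j, A j * x j + c) - (∑ j, A j * x' j + c)| := by
  rcases n with _ | m
  · have := Set.ncard_le_one_of_subsingleton X
    omega
  have := hXfin.to_subtype
  let e : X ≃ Fin N := Finite.equivFinOfCardEq (by rwa [Nat.card_coe_set_eq])
  set p : Fin N → EuclideanSpace ℝ (Fin (m + 1)) := fun i => (e.symm i).1
  have hp : Function.Injective p := Subtype.val_injective.comp e.symm.injective
  have hpX : ∀ i, p i ∈ X := fun i => (e.symm i).2
  have hsurj : ∀ x ∈ X, ∃ i, p i = x := fun x hx => ⟨e ⟨x, hx⟩, by simp [p]⟩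
  obtain ⟨u, hu, hut⟩ := exists_direction (by omega) hp
  set t := √(8 / (Real.pi * ((m : ℝ) + 1))) / N ^ 2 with ht
  have hN' : (0 : ℝ) < N := by exact_mod_cast (by omega : 0 < N)
  have hπ := Real.pi_pos
  have ht0 : 0 < t := by positivity
  have : Nonempty {q : Fin N × Fin N // q.1 ≠ q.2} :=
    ⟨⟨(⟨0, by omega⟩, ⟨1, by omega⟩), by simp⟩⟩
  -- The smallest projected gap `g` becomes the unit of length. Every distance is at most `Δ * dist
  -- (p i₀) (p j₀) ≤ Δ * g / t`, which bounds the range.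
  obtain ⟨⟨⟨i₀, j₀⟩, hij⟩, hmin⟩ := Finite.exists_min
    fun q : {q : Fin N × Fin N // q.1 ≠ q.2} => |inner ℝ u (p q.1.1 - p q.1.2)|
  simp only at hij hmin
  set g := |inner ℝ u (p i₀ - p j₀)|
  have hgt : t * dist (p i₀) (p j₀) ≤ g := hut i₀ j₀
  have hg : 0 < g := lt_of_lt_of_le (mul_pos ht0 (dist_pos.2 (hp.ne hij))) hgt
  have : Nonempty (Fin N) := ⟨i₀⟩
  obtain ⟨k₀, hk₀⟩ := Finite.exists_min fun i => inner ℝ u (p i)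
  have hval : ∀ x, ∑ j, u j / g * x j + -(inner ℝ u (p k₀) / g) = inner ℝ u (x - p k₀) / g := by
    intro x
    rw [inner_sub_right, sub_div, ← sub_eq_add_neg]
    congr 1
    rw [PiLp.inner_apply, Finset.sum_div]
    refine Finset.sum_congr rfl fun j _ => ?_
    simp
    ring
  refine ⟨fun j => u j / g, -(inner ℝ u (p k₀) / g), fun x hx => ?_, fun x hx x' hx' hne => ?_⟩
  · rw [hval]
    obtain ⟨i, rfl⟩ := hsurj x hx
    constructor
    · exact div_nonneg (by rw [inner_sub_right]; linarith [hk₀ i]) hg.le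
    · rw [div_le_iff₀ hg]
      have h1 : inner ℝ u (p i - p k₀) ≤ dist (p i) (p k₀) := by
        refine (real_inner_le_norm _ _).trans ?_
        rw [dist_eq_norm]
        exact mul_le_of_le_one_left (norm_nonneg _) hu
      have h2 := h.dist_le hΔ (hpX i) (hpX k₀) (hpX i₀) (hpX j₀) (hp.ne hij)
      have h3 : √(2 * Real.pi * ((m + 1 : ℕ) : ℝ)) * (N ^ 2 / 4) * t = 1 := by
        have h4 : √(2 * Real.pi * ((m + 1 : ℕ) : ℝ)) * √(8 / (Real.pi * ((m : ℝ) + 1))) = 4 := by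
          rw [← Real.sqrt_mul (by positivity), Real.sqrt_eq_iff_mul_self_eq_of_pos (by norm_num)]
          push_cast
          field_simp
          norm_num
        rw [ht]
        field_simp
        linarith
      calc inner ℝ u (p i - p k₀) ≤ Δ * dist (p i₀) (p j₀) := h1.trans h2
        _ = Δ * √(2 * Real.pi * ((m + 1 : ℕ) : ℝ)) * (N ^ 2 / 4) * (t * dist (p i₀) (p j₀)) := by
            linear_combination (-Δ * dist (p i₀) (p j₀)) * h3
        _ ≤ Δ * √(2 * Real.pi * ((m + 1 : ℕ) : ℝ)) * (N ^ 2 / 4) * g := by gcongr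
  · rw [hval, hval, ← sub_div, ← inner_sub_right, sub_sub_sub_cancel_right, abs_div,
      abs_of_pos hg, le_div_iff₀ hg, one_mul]
    obtain ⟨i, rfl⟩ := hsurj x hx
    obtain ⟨j, rfl⟩ := hsurj x' hx'
    exact hmin ⟨(i, j), fun hij => hne (congrArg p hij)⟩

/-! ### Assembling the network -/

theorem Icc_succ_eq_Ico (a b : ℕ) : Finset.Icc (a + 1) b = Finset.Ico (a + 1) (b + 1) := by
  ext
  simp only [Finset.mem_Icc, Finset.mem_Ico]
  omega

theorem sum_Icc_succ_eq_sum_range (g : ℕ → ℕ) (a b : ℕ) :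
    ∑ ℓ ∈ Finset.Icc (a + 1) b, g ℓ = ∑ i ∈ Finset.range (b - a), g (a + 1 + i) := by
  rw [Icc_succ_eq_Ico, Finset.sum_Ico_eq_sum_range, Nat.add_sub_add_right]

/-- Points at different positions below `A B`, where `A` is the number of neurons available for
step functions, can be memorized by `2 c + 1` further layers for each of `B` positions. -/
theorem Approximable.memorize [Finite α] (hσ : Sigmoidal σ) {s : α → ℕ} (hs : Function.Injective s)
    {f : α → ℝ} (hf : ∀ a, 0 ≤ f a ∧ f a < 1)
    (h : Approximable σ d inp ℓ ![fun a => (s a : ℝ) + f a]) {n B c : ℕ} (hB : 0 < B)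
    (hd : ∀ i < n + B * (2 * c + 1), 3 ≤ d (ℓ + 1 + i))
    (hsA : ∀ a, s a < (∑ i ∈ Finset.range n, (d (ℓ + 1 + i) - 2)) * B) {y : α → ℕ}
    (hy : ∀ a, y a < 2 ^ c) {ε : ℝ} (hε : 0 < ε) :
    ∃ x : α → ℝ, Approximable σ d inp (ℓ + n + B * (2 * c + 1)) ![x] ∧ ∀ a, |x a - y a| ≤ ε := by
  -- Unoccupied positions get label `0`, so that every block has a complete table.
  set label : ℕ → ℕ := Function.extend s y 0
  have hlabel : ∀ q, label q < 2 ^ c := by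
    intro q
    by_cases hq : ∃ a, s a = q
    · obtain ⟨a, rfl⟩ := hq
      simp only [label, hs.extend_apply]
      exact hy a
    · simp only [label, Function.extend_apply' _ _ _ hq, Pi.zero_apply]
      positivity
  have h1 := h.split_blocks hσ hf hB (fun j => (encode c B (fun i => label (B * j + i)) 0 : ℝ)) n
    (fun i hi => hd i (by omega)) hsA
  obtain ⟨x, hx, hxy⟩ := h1.decode hσ (pos := fun a => s a % B)
    (tab := fun a i => label (B * (s a / B) + i)) hf (fun a => Nat.mod_lt _ hB)
    (fun a i => hlabel _) (fun i hi => by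
      have := hd (n + i) (by omega)
      rwa [show ℓ + 1 + (n + i) = ℓ + n + 1 + i by omega] at this) hε
  refine ⟨x, hx, fun a => ?_⟩
  have := hxy a
  simp only [Nat.div_add_mod] at this
  rwa [show label (s a) = y a from hs.extend_apply _ _ _] at this

end Memorization

open Memorization in
theorem theorem3
    (σ : ℝ → ℝ) (hσ : Memorization.Sigmoidal σ)
    (L : ℕ) (d : ℕ → ℕ) (hd : ∀ ℓ : ℕ, 1 ≤ ℓ → ℓ ≤ L → 3 ≤ d ℓ)
    (C N : ℕ) (Δ : ℝ) (hΔ : 1 < Δ)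
    (hM : ∃ (K : ℕ) (M : ℕ → ℕ), 2 ≤ K ∧ (K : ℝ) ≤ Real.logb 2 N ∧
      0 < M 1 ∧ (∀ i : ℕ, 1 ≤ i → i < K → M i < M (i + 1)) ∧ M K < L ∧
      Δ * Real.sqrt (2 * Real.pi * (d 0 : ℝ)) ≤
        ((∏ ℓ ∈ Finset.Icc 1 (M 1), (d ℓ + 1) / 2 : ℕ) : ℝ) ∧
      (∀ i : ℕ, 1 < i → i ≤ K - 1 →
        2 ^ (i + 3) ≤ ∑ ℓ ∈ Finset.Icc (M (i - 1) + 1) (M i), (d ℓ - 2)) ∧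
      N ^ 2 + 4 ≤
        2 ^ K * (∑ ℓ ∈ Finset.Icc (M (K - 1) + 1) (M K), (d ℓ - 2)) *
          ((L - M K) / (2 * ⌈Real.logb 2 C⌉₊ + 1)))
    (X : Set (EuclideanSpace ℝ (Fin (d 0)))) (hXfin : X.Finite) (hXcard : X.ncard = N)
    (hXsep : Memorization.Separated Δ X) (y : X → Fin C) :
    Memorization.CanMemorize σ d L X y := by
  obtain ⟨K, M, hK, hKN, hM1, hMlt, hML, hprod, hsum, hfin⟩ := hM
  have hKN' : 2 ^ K ≤ N := by
    have hN0 : (0 : ℝ) < N := by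
      rcases Nat.eq_zero_or_pos N with h0 | h0
      · rw [h0, Nat.cast_zero, Real.logb_zero] at hKN
        have : K ≤ 0 := by exact_mod_cast hKN
        omega
      · exact_mod_cast h0
    have := (Real.le_logb_iff_rpow_le one_lt_two hN0).1 hKN
    rw [Real.rpow_natCast] at this
    exact_mod_cast this
  have hN4 : 2 ^ 2 ≤ N := (Nat.pow_le_pow_right two_pos hK).trans hKN'
  have hMmono : ∀ i j, 1 ≤ i → i ≤ j → j ≤ K → M i ≤ M j := by
    intro i j hi hij
    induction j, hij using Nat.le_induction with
    | base => exact fun _ => le_rfl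
    | succ j hij ih => exact fun hj => (ih (by omega)).trans (hMlt j (by omega) (by omega)).le
  have hMK : ∀ i, 1 ≤ i → i ≤ K → M i ≤ M K := fun i hi hiK => hMmono i K hi hiK le_rfl
  let _ : Fintype X := hXfin.fintype
  have hcard : Fintype.card X = N := by
    rw [← hXcard, ← Nat.card_coe_set_eq, Nat.card_eq_fintype_card]
  obtain ⟨A, e, hrange, hgap⟩ :=
    hXsep.exists_projection (by omega) (by linarith) hXfin hXcard
  set b : X → ℝ := fun x => ∑ j, A j * x.1 j + e
  set f : X → ℝ := fun x => Int.fract (b x)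
  have hf : ∀ x, 0 ≤ f x ∧ f x < 1 := fun x => ⟨Int.fract_nonneg _, Int.fract_lt_one _⟩
  -- `T i` is `(N² + 4) / 2 ^ (i + 1)` rounded up, the length of the range after stage `i`. Thus `4
  -- * T 1 > N²`, `T i ≤ 2 * T (i + 1)`, and condition 3 bounds `T (K - 1)`.
  have hthr : ∀ i : ℕ, ∃ T : ℕ, N ^ 2 + 4 ≤ 2 ^ (i + 1) * T ∧
      ∀ c, N ^ 2 + 4 ≤ 2 ^ (i + 1) * c → T ≤ c := by
    intro i
    have hex : ∃ T, N ^ 2 + 4 ≤ 2 ^ (i + 1) * T :=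
      ⟨N ^ 2 + 4, Nat.le_mul_of_pos_left _ (by positivity)⟩
    classical
    exact ⟨Nat.find hex, Nat.find_spec hex, fun c hc => Nat.find_min' hex hc⟩
  choose T hT hTmin using hthr
  have hTpos : ∀ i, 0 < T i := fun i => Nat.pos_of_ne_zero fun h0 => by
    have := hT i
    rw [h0, mul_zero] at this
    omega
  have hfold : ∀ i, 1 ≤ i → i ≤ K - 1 → ∃ s : X → ℤ, Function.Injective s ∧
      (∀ x, 0 ≤ s x ∧ s x < T i) ∧
      Approximable σ d (fun x : X => x.1) (M i) ![fun x => (s x : ℝ) + f x] := by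
    intro i hi
    induction i, hi using Nat.le_induction with
    | base =>
      intro _
      have h0 : Approximable σ d (fun x : X => x.1) 0 ![fun x => ((⌊b x⌋ : ℤ) : ℝ) + f x] :=
        (approximable_input ![A] ![e]).congr fun i x => by
          simp [b, f, Int.floor_add_fract]
      have hinj : Function.Injective fun x : X => ⌊b x⌋ := by
        intro x x' hxx
        by_contra hne
        exact absurd (Int.abs_sub_lt_one_of_floor_eq_floor hxx)
          (not_lt.2 (hgap x x.2 x' x'.2 fun h => hne (Subtype.ext h)))
      have hP : ∏ ℓ ∈ Finset.Icc 1 (M 1), (d ℓ + 1) / 2 =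
          ∏ i ∈ Finset.range (M 1), (d (0 + 1 + i) + 1) / 2 := by
        rw [show Finset.Icc 1 (M 1) = _ from Icc_succ_eq_Ico 0 (M 1),
          Finset.prod_Ico_eq_prod_range, Nat.add_sub_add_right, Nat.sub_zero]
      have hdM : ∀ i < M 1, 3 ≤ d (0 + 1 + i) := fun i hi =>
        hd _ (by omega) (by have := hMK 1 le_rfl (by omega); omega)
      have hT1 := hT 1
      rw [hP] at hprod
      obtain ⟨s, hs, hsT, h⟩ := exists_fold_blocks_layers hσ hf hinj h0 (M 1) hdM
        (T := T 1) (by exact_mod_cast hTpos 1) (by rw [hcard]; exact_mod_cast (by omega)) (by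
          intro x
          obtain ⟨hx0, hx1⟩ := hrange x x.2
          refine ⟨Int.floor_nonneg.2 hx0, Int.floor_lt.2 ?_⟩
          push_cast at hprod ⊢
          set P : ℝ := ∏ i ∈ Finset.range (M 1), (((d (0 + 1 + i) + 1) / 2 : ℕ) : ℝ)
          have hP0 : 0 < P := Finset.prod_pos fun i hi => by
            have := hdM i (Finset.mem_range.1 hi)
            exact_mod_cast (by omega : 0 < (d (0 + 1 + i) + 1) / 2)
          have hT1' : (N : ℝ) ^ 2 + 4 ≤ 4 * T 1 := by exact_mod_cast hT1
          calc b x ≤ P * (N ^ 2 / 4) := hx1.trans (by gcongr)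
            _ < P * T 1 := by gcongr; linarith)
      rw [zero_add] at h
      exact ⟨s, hs, hsT, h⟩
    | succ i hi ih =>
      intro hiK
      obtain ⟨s, hs, hsT, h⟩ := ih (by omega)
      have hle := hMmono i (i + 1) hi (by omega) (by omega)
      have hleK := hMK (i + 1) (by omega) (by omega)
      have hT1 := hT (i + 1)
      have hTi : T i ≤ 2 * T (i + 1) := hTmin i _ (by
        rw [← mul_assoc, ← pow_succ]; exact hT1)
      have hw := hsum (i + 1) (by omega) hiK
      rw [Nat.add_sub_cancel, sum_Icc_succ_eq_sum_range (fun ℓ => d ℓ - 2)] at hw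
      have hNpow : 2 ^ (i + 2) ≤ N := (Nat.pow_le_pow_right two_pos (by omega)).trans hKN'
      -- `K ≤ log N` enters here: with `m = ⌊N / 2 ^ (i + 2)⌋ ≥ 1`, rounding loses at most a factor
      -- `2`, so `2 ^ (i + 3)` intervals of at most `m` points suffice, while `m N < T (i + 1)`.
      have hm1 : 1 ≤ N / 2 ^ (i + 2) := (Nat.one_le_div_iff (by positivity)).2 hNpow
      have hmN : 2 ^ (i + 2) * (N / 2 ^ (i + 2)) ≤ N := Nat.mul_div_le _ _
      have hNm : N < 2 ^ (i + 2) * (N / 2 ^ (i + 2) + 1) :=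
        Nat.lt_mul_div_succ _ (by positivity)
      obtain ⟨s', hs', hsT', h'⟩ := exists_fold_halve_layers hσ hf hs h (M (i + 1) - M i)
        (fun j hj => hd _ (by omega) (by omega)) (D := T (i + 1)) (m := N / 2 ^ (i + 2))
        (k := 2 ^ (i + 3)) (by exact_mod_cast hTpos _) (by
          rw [hcard, Int.ofNat_lt]
          have h2 : 2 ^ (i + 2) * (N / 2 ^ (i + 2) * N) < 2 ^ (i + 2) * T (i + 1) := by
            calc 2 ^ (i + 2) * (N / 2 ^ (i + 2) * N) = 2 ^ (i + 2) * (N / 2 ^ (i + 2)) * N := by ring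
              _ ≤ N * N := Nat.mul_le_mul_right _ hmN
              _ < N ^ 2 + 4 := by rw [sq]; omega
              _ ≤ _ := hT1
          exact Nat.lt_of_mul_lt_mul_left h2) (by
          rw [hcard]
          calc N ≤ 2 ^ (i + 2) * (N / 2 ^ (i + 2) + 1) := hNm.le
            _ ≤ 2 ^ (i + 2) * (N / 2 ^ (i + 2) + N / 2 ^ (i + 2)) := by gcongr
            _ = 2 ^ (i + 3) * (N / 2 ^ (i + 2)) := by ring) (by
          refine le_trans (le_of_eq ?_) hw
          ring) (fun x => ⟨(hsT x).1, by
            have h3 := (hsT x).2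
            have h4 : (T i : ℤ) ≤ 2 * T (i + 1) := by exact_mod_cast hTi
            omega⟩)
      rw [Nat.add_sub_cancel' hle] at h'
      exact ⟨s', hs', hsT', h'⟩
  obtain ⟨s, hs, hsT, h⟩ := hfold (K - 1) (by omega) le_rfl
  set c := ⌈Real.logb 2 C⌉₊
  set B := (L - M K) / (2 * c + 1)
  rw [sum_Icc_succ_eq_sum_range (fun ℓ => d ℓ - 2)] at hfin
  -- Condition 3 cannot hold if its last factor vanishes.
  have hB : 0 < B := Nat.pos_of_ne_zero fun h0 => by
    rw [h0, mul_zero] at hfin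
    omega
  have hTK : T (K - 1) ≤
      (∑ i ∈ Finset.range (M K - M (K - 1)), (d (M (K - 1) + 1 + i) - 2)) * B :=
    hTmin (K - 1) _ (by rw [Nat.sub_add_cancel (by omega), ← mul_assoc]; exact hfin)
  have hBL : B * (2 * c + 1) ≤ L - M K := Nat.div_mul_le_self _ _
  have hle := hMmono (K - 1) K (by omega) (by omega) le_rfl
  have hs0 : ∀ x, ((s x).toNat : ℤ) = s x := fun x => Int.toNat_of_nonneg (hsT x).1
  refine canMemorize_of_approximable fun ε hε => ?_
  obtain ⟨x, hx, hxy⟩ := Approximable.memorize hσ (s := fun x => (s x).toNat)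
    (fun x x' hxx => hs (by rw [← hs0 x, ← hs0 x']; exact congrArg _ hxx)) hf
    (h.congr (G := ![fun x => (((s x).toNat : ℕ) : ℝ) + f x]) fun i x => by
      have : (((s x).toNat : ℕ) : ℝ) = s x := by exact_mod_cast hs0 x
      simp [this])
    (n := M K - M (K - 1)) (c := c) hB (fun i hi => hd _ (by omega) (by omega))
    (fun x => by
      have h1 := (hsT x).2
      have h2 := hs0 x
      omega) (y := fun x => y x) (fun x => by
      have hC : 0 < C := (y x).pos
      refine (y x).isLt.trans_le ?_
      have h1 : Real.logb 2 C ≤ c := Nat.le_ceil _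
      rw [Real.logb_le_iff_le_rpow one_lt_two (by exact_mod_cast hC), Real.rpow_natCast] at h1
      exact_mod_cast h1) hε
  refine ⟨x, ?_, hxy⟩
  have hL : M (K - 1) + (M K - M (K - 1)) + B * (2 * c + 1) = M K + B * (2 * c + 1) := by omega
  -- The layers left over by the rounding in `B` only pass the result on.
  have hcarry := hx.carry hσ (L - M K - B * (2 * c + 1)) fun i hi =>
    le_trans (by norm_num) (hd _ (by omega) (by omega))
  rwa [hL, show M K + B * (2 * c + 1) + (L - M K - B * (2 * c + 1)) = L by omega] at hcarry
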